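/- Theorem (uniform consistency under the nonuniform random hypergraph model). Let $M\in\mathbb N$ and $C_1\ge 1$. There is a constant $C>0$, depending only on $M$ and $C_1$, such that the following holds. For every $n\ge M$ let $\bm u^*=\bm u^*_n\in\mathbb R^n$ be a utility vector with $\sum_{k\in[n]}u^*_k=0$ and $\|\bm u^*\|_\infty\le\log C_1$. Let the comparison hypergraph $\mathsf H_n=([n],E_n)$ be drawn from a nonuniform random hypergraph model: every edge $e\in E_n$ has size $2\le |e|\le M$, and the indicators $\mathbf 1_{\{e\in E_n\}}$, over all $e\subseteq[n]$ with $2\le|e|\le M$, are independent Bernoulli variables with parameters $p_{e,n}$. Put $$\xi_{n,-}=\sum_{m=2}^M n^{m-1}\min_{e\subseteq[n],\,|e|=m}p_{e,n},\qquad \xi_{n,+}=\sum_{m=2}^M n^{m-1}\max_{e\subseteq[n],\,|e|=m}p_{e,n},$$ and assume that $\xi_{n,-}>0$ for all large $n$ and that $\xi_{n,+}^2(\log n)^3/\xi_{n,-}^3\to0$ as $n\to\infty$. Conditionally on $E_n$, let the edges $T\in E_n$ carry independent rankings $\pi_T$ from the Plackett–Luce model: a ranking $\pi_T(1)\succ\cdots\succ\pi_T(|T|)$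 of $T$ has probability $$\prod_{j=1}^{|T|}\frac{e^{u^*_{\pi_T(j)}}}{\sum_{t=j}^{|T|}e^{u^*_{\pi_T(t)}}}.$$ All these random objects, for all $n$, live on one probability space; no assumption is made on their joint law for different $n$. For each edge $T\in E_n$ let $y_T\in\{1,\dots,|T|\}$ be given numbers, allowed to depend on $n$ and on $E_n$ but not on the rankings. The marginal MLE $\widehat{\bm u}$ and the QMLE $\widetilde{\bm u}$ are the maximizers, over $\{\bm u\in\mathbb R^n:\sum_{k}u_k=0\}$, of $$l_1(\bm u)=\sum_{T\in E_n}\sum_{j=1}^{y_T}\Big[u_{\pi_T(j)}-\log\sum_{t=j}^{|T|}e^{u_{\pi_T(t)}}\Big],\qquad l_2(\bm u)=\sum_{T\in E_n}\sum_{1\le j<t\le|T|}\Big[u_{\pi_T(j)}-\log\big(e^{u_{\pi_T(j)}}+e^{u_{\pi_T(t)}}\big)\Big],$$ respectively. Then, almost surely, for all sufficiently large $n$, $\widehat{\bm u}$ and $\widetilde{\bm u}$ both exist and are unique, and for $\bm w=\widehat{\bm u}$ and for $\bm w=\widetilde{\bm u}$ $$\|\bm w-\bm u^*\|_\infty\le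 C\sqrt{\frac{\xi_{n,+}^2(\log n)^3}{\xi_{n,-}^3}},$$ where the right-hand side tends to $0$ as $n\to\infty$. -/

import Mathlib

open MeasureTheory ProbabilityTheory Filter
open scoped Topology

noncomputable section

namespace PLModel

/-- A full ranking of the finite set `T` of objects: `π j` is the object of rank `j + 1`
(ranks are counted from `0`). -/
abbrev Ranking {n : ℕ} (T : Finset (Fin n)) : Type := Fin T.card ≃ T

/-- Plackett–Luce probability of the ranking `π` of `T` under the utility vector `u`:
`∏_j exp (u_{π j}) / ∑_{t ≥ j} exp (u_{π t})`. -/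
def plProb {n : ℕ} (u : Fin n → ℝ) {T : Finset (Fin n)} (π : Ranking T) : ℝ :=
  ∏ j : Fin T.card, Real.exp (u (π j)) / ∑ t ∈ Finset.Ici j, Real.exp (u (π t))

/-- Marginal log-likelihood based on the top `y T` objects of the ranking of each edge `T` of the
comparison hypergraph `G`. -/
def marginalLogLik {n : ℕ} (G : Finset (Finset (Fin n))) (π : ∀ T : Finset (Fin n), Ranking T)
    (y : Finset (Fin n) → ℕ) (u : Fin n → ℝ) : ℝ :=
  ∑ T ∈ G, ∑ j ∈ Finset.univ.filter (fun j : Fin T.card => (j : ℕ) < y T),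
    (u (π T j) - Real.log (∑ t ∈ Finset.Ici j, Real.exp (u (π T t))))

/-- Quasi log-likelihood based on the full breaking of each ranking into pairwise comparisons. -/
def quasiLogLik {n : ℕ} (G : Finset (Finset (Fin n))) (π : ∀ T : Finset (Fin n), Ranking T)
    (u : Fin n → ℝ) : ℝ :=
  ∑ T ∈ G, ∑ j : Fin T.card, ∑ t ∈ Finset.Ioi j,
    (u (π T j) - Real.log (Real.exp (u (π T j)) + Real.exp (u (π T t))))

/-- `w` maximizes `l` over the vectors whose coordinates sum to zero. -/
def IsCenteredMaximizer {n : ℕ} (l : (Fin n → ℝ) → ℝ) (w : Fin n → ℝ) : Prop :=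
  ∑ k, w k = 0 ∧ ∀ v : Fin n → ℝ, ∑ k, v k = 0 → l v ≤ l w

/-- `w` is a marginal maximum likelihood estimator. -/
def IsMarginalMLE {n : ℕ} (G : Finset (Finset (Fin n))) (π : ∀ T : Finset (Fin n), Ranking T)
    (y : Finset (Fin n) → ℕ) (w : Fin n → ℝ) : Prop :=
  IsCenteredMaximizer (marginalLogLik G π y) w

/-- `w` is a quasi maximum likelihood estimator. -/
def IsQMLE {n : ℕ} (G : Finset (Finset (Fin n))) (π : ∀ T : Finset (Fin n), Ranking T)
    (w : Fin n → ℝ) : Prop :=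
  IsCenteredMaximizer (quasiLogLik G π) w

/-- The random edge set `E` on the vertex set `Fin n` is drawn from the nonuniform random
hypergraph model: edges have size between `2` and `M`, and the indicators of the events `e ∈ E`,
for `e` of such a size, are independent Bernoulli variables with parameters `p e`. -/
structure IsNURHM {Ω : Type*} [MeasurableSpace Ω] (P : Measure Ω) (M : ℕ) {n : ℕ}
    (p : Finset (Fin n) → ℝ) (E : Ω → Finset (Finset (Fin n))) : Prop where
  measurableSet_mem : ∀ e, MeasurableSet {ω | e ∈ E ω}
  card_mem : ∀ ω, ∀ e ∈ E ω, 2 ≤ e.card ∧ e.card ≤ M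
  prob_mem : ∀ e : Finset (Fin n), 2 ≤ e.card → e.card ≤ M → P.real {ω | e ∈ E ω} = p e
  indep : iIndepSet
    (fun e : {e : Finset (Fin n) // 2 ≤ e.card ∧ e.card ≤ M} => {ω | (e : Finset (Fin n)) ∈ E ω}) P

/-- Conditionally on the random edge set `E`, the rankings `π T` of the edges `T ∈ E` are
independent and follow the Plackett–Luce model with utility vector `u`. The values of `π T` for
`T ∉ E` are irrelevant. -/
structure IsPLSample {Ω : Type*} [MeasurableSpace Ω] (P : Measure Ω) {n : ℕ} (u : Fin n → ℝ)
    (E : Ω → Finset (Finset (Fin n))) (π : Ω → ∀ T : Finset (Fin n), Ranking T) : Prop where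
  measurableSet_ranking : ∀ (T : Finset (Fin n)) (σ : Ranking T),
    MeasurableSet {ω | T ∈ E ω ∧ π ω T = σ}
  law : ∀ (G : Finset (Finset (Fin n))) (σ : ∀ T : Finset (Fin n), Ranking T),
    P.real {ω | E ω = G ∧ ∀ T ∈ G, π ω T = σ T}
      = P.real {ω | E ω = G} * ∏ T ∈ G, plProb u (σ T)

/-- `ξ_{n,-} = ∑_{m=2}^M n^{m-1} min_{|e| = m} p_e`. -/
def xiMinus (M : ℕ) {n : ℕ} (p : Finset (Fin n) → ℝ) : ℝ :=
  ∑ m ∈ Finset.Icc 2 M, (n : ℝ) ^ (m - 1) * ⨅ e : {e : Finset (Fin n) // e.card = m}, p e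

/-- `ξ_{n,+} = ∑_{m=2}^M n^{m-1} max_{|e| = m} p_e`. -/
def xiPlus (M : ℕ) {n : ℕ} (p : Finset (Fin n) → ℝ) : ℝ :=
  ∑ m ∈ Finset.Icc 2 M, (n : ℝ) ^ (m - 1) * ⨆ e : {e : Finset (Fin n) // e.card = m}, p e

/-- `ξ_{n,+}² (log n)³ / ξ_{n,-}³`. -/
def sparsityRatio (M : ℕ) {n : ℕ} (p : Finset (Fin n) → ℝ) : ℝ :=
  xiPlus M p ^ 2 * Real.log n ^ 3 / xiMinus M p ^ 3

end PLModel

end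

/-! Both likelihoods are sums of log-probabilities of Luce choices: the marginal one breaks a
ranking into stagewise choices from the objects still unranked, the quasi one into pairwise
comparisons. All deterministic work is done for an abstract `IsBreaking`, whose essential property
is that any two vertices of an edge compete in some choice. The gradient is tested only against
indicators of vertex sets `S`, and the log-likelihood is invariant under constants, so this score
vanishes at a centered maximizer `w` for every `S`.

The error bound is a chaining argument on the superlevel sets of `w - u` (`IsRegular.growth`). Let
`S` be such a set with at most half of the vertices. If lowering the level by `g` added few
vertices, the degree bound would leave at least half of the edges crossing `S` free of the new ones;
on each of these edges `w - u` drops by at least `g`, and `le_choiceProb_sub` makes the score at `u`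
exceed the score at `w`, which is zero, by a multiple of `g` times the number of crossing edges.
Concentration of the score at `u` forbids this for `g` of order `√(log n / ξ₋)`. Hence superlevel
sets grow by a factor `1 + η`, with `η` of order `ξ₋ / ξ₊`, and pass half of the vertices after
order `log n / η` steps. The same holds for `u - w`, so the two sets meet and the oscillation of `w
- u` is at most the number of steps times `2 g`, which is the claimed rate. No a priori bound on `w`
is needed.

Existence follows from Ford's condition, itself a consequence of the small score at `u`
(`IsBreaking.exists_mem_of_score`); uniqueness follows from connectivity.

The probabilistic part provides `IsRegular`: Chernoff bounds for numbers of crossing and touching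
edges, and Hoeffding's inequality conditionally on the edges (`IsPLSample.abs_tail`), where only
crossing edges contribute. A union bound over all `S` (`measure_exists_finset_le`) and
Borel–Cantelli conclude; the latter needs nothing about the joint law for different `n`. -/

namespace PLModel

/-! ### Luce choices: probabilities, likelihood and score -/

section Choice

lemma sum_exp_pos {V : Type*} {A : Finset V} (hA : A.Nonempty) (u : V → ℝ) :
    0 < ∑ k ∈ A, Real.exp (u k) :=
  Finset.sum_pos (fun _ _ => Real.exp_pos _) hA

variable {V ι : Type*} [DecidableEq V]

/-- The probability that a choice from `A` under Luce's rule with utilities `u` lies in `S`. -/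
noncomputable def choiceProb (u : V → ℝ) (A S : Finset V) : ℝ :=
  (∑ k ∈ A ∩ S, Real.exp (u k)) / ∑ k ∈ A, Real.exp (u k)

/-- Log-likelihood of the choices `i c` from the sets `A c`, for `c ∈ s`. -/
noncomputable def choiceLogLik (s : Finset ι) (i : ι → V) (A : ι → Finset V) (u : V → ℝ) : ℝ :=
  ∑ c ∈ s, (u (i c) - Real.log (∑ k ∈ A c, Real.exp (u k)))

/-- Derivative of `choiceLogLik` in the direction of the indicator function of `S`. -/
noncomputable def choiceScore (s : Finset ι) (i : ι → V) (A : ι → Finset V) (u : V → ℝ)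
    (S : Finset V) : ℝ :=
  ∑ c ∈ s, ((if i c ∈ S then 1 else 0) - choiceProb u (A c) S)

lemma choiceProb_nonneg (u : V → ℝ) (A S : Finset V) : 0 ≤ choiceProb u A S :=
  div_nonneg (Finset.sum_nonneg fun _ _ => (Real.exp_pos _).le)
    (Finset.sum_nonneg fun _ _ => (Real.exp_pos _).le)

lemma choiceProb_le_one (u : V → ℝ) (A S : Finset V) : choiceProb u A S ≤ 1 :=
  div_le_one_of_le₀ (Finset.sum_le_sum_of_subset_of_nonneg Finset.inter_subset_left
    fun _ _ _ => (Real.exp_pos _).le) (Finset.sum_nonneg fun _ _ => (Real.exp_pos _).le)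

lemma choiceProb_of_subset {A S : Finset V} (hA : A.Nonempty) (h : A ⊆ S) (u : V → ℝ) :
    choiceProb u A S = 1 := by
  rw [choiceProb, Finset.inter_eq_left.mpr h, div_self (sum_exp_pos hA u).ne']

lemma choiceProb_of_disjoint {A S : Finset V} (h : Disjoint A S) (u : V → ℝ) :
    choiceProb u A S = 0 := by
  rw [choiceProb, Finset.disjoint_iff_inter_eq_empty.mp h, Finset.sum_empty, zero_div]

lemma choiceProb_compl [Fintype V] {A : Finset V} (hA : A.Nonempty) (u : V → ℝ) (S : Finset V) :
    choiceProb u A Sᶜ = 1 - choiceProb u A S := by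
  have h := sum_exp_pos hA u
  rw [choiceProb, choiceProb, eq_sub_iff_add_eq, ← add_div, div_eq_one_iff_eq h.ne',
    ← Finset.sdiff_eq_inter_compl, add_comm]
  exact Finset.sum_inter_add_sum_sdiff A S _

lemma choiceScore_compl [Fintype V] {s : Finset ι} {i : ι → V} {A : ι → Finset V}
    (hi : ∀ c ∈ s, i c ∈ A c) (u : V → ℝ) (S : Finset V) :
    choiceScore s i A u Sᶜ = -choiceScore s i A u S := by
  rw [choiceScore, choiceScore, ← Finset.sum_neg_distrib]
  refine Finset.sum_congr rfl fun c hc => ?_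
  rw [choiceProb_compl ⟨_, hi c hc⟩]
  by_cases h : i c ∈ S <;> simp [h]

lemma choiceProb_sub {A : Finset V} (hA : A.Nonempty) (u v : V → ℝ) (U : Finset V) :
    choiceProb v A U - choiceProb u A U =
      (∑ x ∈ A ∩ U, ∑ y ∈ A \ U, (Real.exp (v x + u y) - Real.exp (u x + v y))) /
        ((∑ k ∈ A, Real.exp (v k)) * ∑ k ∈ A, Real.exp (u k)) := by
  rw [choiceProb, choiceProb, div_sub_div _ _ (sum_exp_pos hA v).ne' (sum_exp_pos hA u).ne']
  congr 1
  rw [← Finset.sum_inter_add_sum_sdiff A U (fun k => Real.exp (v k)),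
    ← Finset.sum_inter_add_sum_sdiff A U (fun k => Real.exp (u k))]
  simp only [Finset.sum_sub_distrib, Real.exp_add]
  simp only [← Finset.sum_mul_sum]
  ring

lemma choiceProb_le_choiceProb {A : Finset V} (hA : A.Nonempty) {u v : V → ℝ} {U : Finset V}
    (h : ∀ x ∈ U, ∀ y ∉ U, v y - u y ≤ v x - u x) : choiceProb u A U ≤ choiceProb v A U := by
  rw [← sub_nonneg, choiceProb_sub hA]
  refine div_nonneg (Finset.sum_nonneg fun x hx => Finset.sum_nonneg fun y hy => ?_)
    (mul_pos (sum_exp_pos hA v) (sum_exp_pos hA u)).le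
  rw [sub_nonneg, Real.exp_le_exp]
  linarith [h x (Finset.mem_inter.mp hx).2 y (Finset.mem_sdiff.mp hy).2]

/-- If the increments of the utilities are larger on `U` than off `U`, with a gap `g` for some pair
of elements of `A`, then the probability of choosing from `U` increases proportionally to `g`. -/
lemma le_choiceProb_sub {A : Finset V} {u v : V → ℝ} {U : Finset V} {B g : ℝ} {m : ℕ}
    (h : ∀ x ∈ U, ∀ y ∉ U, v y - u y ≤ v x - u x) (hu : ∀ k, |u k| ≤ B) (hm : A.card ≤ m)
    (hg : 0 ≤ g) (hg1 : g ≤ 1) {x y : V} (hxA : x ∈ A) (hxU : x ∈ U) (hyA : y ∈ A) (hyU : y ∉ U)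
    (hxy : g ≤ (v x - u x) - (v y - u y)) :
    g / (2 * m ^ 2 * Real.exp (4 * B)) ≤ choiceProb v A U - choiceProb u A U := by
  have hA : A.Nonempty := ⟨x, hxA⟩
  -- The largest increment `d` on `A` is attained at `z`. It bounds the normalizer of `v` by `m *
  -- exp (B + d)` and appears as `exp d` in the numerator, so it cancels and `v` itself need not be
  -- bounded.
  obtain ⟨z, hz, hzmax⟩ := Finset.exists_max_image (A ∩ U) (fun k => v k - u k)
    ⟨x, Finset.mem_inter.mpr ⟨hxA, hxU⟩⟩
  have hmax : ∀ k ∈ A, v k - u k ≤ v z - u z := by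
    intro k hk
    by_cases hkU : k ∈ U
    · exact hzmax k (Finset.mem_inter.mpr ⟨hk, hkU⟩)
    · exact h z (Finset.mem_inter.mp hz).2 k hkU
  have hzy : g ≤ (v z - u z) - (v y - u y) := by linarith [hmax x hxA]
  set d := v z - u z with hd
  have hm0 : (0 : ℝ) < m := by
    exact_mod_cast lt_of_lt_of_le (Finset.card_pos.mpr hA) hm
  have hv_le : ∑ k ∈ A, Real.exp (v k) ≤ m * Real.exp (B + d) := by
    calc ∑ k ∈ A, Real.exp (v k) ≤ ∑ _k ∈ A, Real.exp (B + d) := by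
          refine Finset.sum_le_sum fun k hk => Real.exp_le_exp.mpr ?_
          linarith [hmax k hk, (abs_le.mp (hu k)).2]
      _ ≤ m * Real.exp (B + d) := by
          rw [Finset.sum_const, nsmul_eq_mul]
          gcongr
  have hu_le : ∑ k ∈ A, Real.exp (u k) ≤ m * Real.exp B := by
    calc ∑ k ∈ A, Real.exp (u k) ≤ ∑ _k ∈ A, Real.exp B := by
          refine Finset.sum_le_sum fun k hk => Real.exp_le_exp.mpr (abs_le.mp (hu k)).2
      _ ≤ m * Real.exp B := by
          rw [Finset.sum_const, nsmul_eq_mul]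
          gcongr
  have hterm : Real.exp (-(2 * B) + d) * (g / 2) ≤
      Real.exp (v z + u y) - Real.exp (u z + v y) := by
    have h1 : Real.exp (u z + v y) ≤ Real.exp (v z + u y) * Real.exp (-g) := by
      rw [← Real.exp_add, Real.exp_le_exp]
      linarith
    have h2 : Real.exp (-g) ≤ 1 - g / 2 := by
      have h3 : (1 + g) * Real.exp (-g) ≤ 1 := by
        calc (1 + g) * Real.exp (-g) ≤ Real.exp g * Real.exp (-g) := by
              gcongr
              linarith [Real.add_one_le_exp g]
          _ = 1 := by rw [← Real.exp_add, add_neg_cancel, Real.exp_zero]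
      nlinarith [Real.exp_pos (-g)]
    have h4 : Real.exp (-(2 * B) + d) ≤ Real.exp (v z + u y) := by
      rw [Real.exp_le_exp]
      linarith [(abs_le.mp (hu z)).1, (abs_le.mp (hu y)).1]
    calc Real.exp (-(2 * B) + d) * (g / 2) ≤ Real.exp (v z + u y) * (g / 2) := by gcongr
      _ ≤ Real.exp (v z + u y) - Real.exp (v z + u y) * Real.exp (-g) := by
          nlinarith [Real.exp_pos (v z + u y)]
      _ ≤ _ := by linarith
  have hnonneg : ∀ a ∈ A ∩ U, ∀ b ∈ A \ U,
      0 ≤ Real.exp (v a + u b) - Real.exp (u a + v b) := by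
    intro a ha b hb
    rw [sub_nonneg, Real.exp_le_exp]
    linarith [h a (Finset.mem_inter.mp ha).2 b (Finset.mem_sdiff.mp hb).2]
  have hnum : Real.exp (-(2 * B) + d) * (g / 2) ≤
      ∑ x ∈ A ∩ U, ∑ y ∈ A \ U, (Real.exp (v x + u y) - Real.exp (u x + v y)) := by
    refine hterm.trans (le_trans ?_ (Finset.single_le_sum
      (fun a ha => Finset.sum_nonneg (hnonneg a ha)) hz))
    exact Finset.single_le_sum (hnonneg z hz) (Finset.mem_sdiff.mpr ⟨hyA, hyU⟩)
  rw [choiceProb_sub hA]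
  calc g / (2 * m ^ 2 * Real.exp (4 * B))
      = (Real.exp (-(2 * B) + d) * (g / 2)) / ((m * Real.exp (B + d)) * (m * Real.exp B)) := by
        rw [div_eq_div_iff (by positivity) (by positivity)]
        have : Real.exp (-(2 * B) + d) * Real.exp (4 * B) = Real.exp (B + d) * Real.exp B := by
          rw [← Real.exp_add, ← Real.exp_add]
          congr 1
          ring
        linear_combination (-g * m ^ 2) * this
    _ ≤ _ := div_le_div₀ (Finset.sum_nonneg fun a ha => Finset.sum_nonneg (hnonneg a ha)) hnum
        (mul_pos (sum_exp_pos hA v) (sum_exp_pos hA u))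
        (mul_le_mul hv_le hu_le (sum_exp_pos hA u).le (by positivity))

lemma le_choiceProb {A S : Finset V} {u : V → ℝ} {B : ℝ} {m : ℕ} (hu : ∀ k, |u k| ≤ B)
    (hm : A.card ≤ m) (h : (A ∩ S).Nonempty) :
    1 / (m * Real.exp (2 * B)) ≤ choiceProb u A S := by
  obtain ⟨x, hx⟩ := h
  have hA : A.Nonempty := ⟨x, (Finset.mem_inter.mp hx).1⟩
  have hm0 : (0 : ℝ) < m := by
    exact_mod_cast lt_of_lt_of_le (Finset.card_pos.mpr hA) hm
  have hu_le : ∑ k ∈ A, Real.exp (u k) ≤ m * Real.exp B := by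
    calc ∑ k ∈ A, Real.exp (u k) ≤ ∑ _k ∈ A, Real.exp B := by
          refine Finset.sum_le_sum fun k hk => Real.exp_le_exp.mpr (abs_le.mp (hu k)).2
      _ ≤ m * Real.exp B := by
          rw [Finset.sum_const, nsmul_eq_mul]
          gcongr
  have hnum : Real.exp (-B) ≤ ∑ k ∈ A ∩ S, Real.exp (u k) :=
    (Real.exp_le_exp.mpr (abs_le.mp (hu x)).1).trans
      (Finset.single_le_sum (f := fun k => Real.exp (u k)) (fun _ _ => (Real.exp_pos _).le) hx)
  calc 1 / (m * Real.exp (2 * B)) = Real.exp (-B) / (m * Real.exp B) := by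
        rw [div_eq_div_iff (by positivity) (by positivity)]
        have : Real.exp (-B) * Real.exp (2 * B) = Real.exp B := by
          rw [← Real.exp_add]; congr 1; ring
        linear_combination (-m : ℝ) * this
    _ ≤ _ := div_le_div₀ (Finset.sum_nonneg fun _ _ => (Real.exp_pos _).le) hnum
        (sum_exp_pos hA u) hu_le

omit [DecidableEq V] in
lemma choiceLogLik_add_const {s : Finset ι} {i : ι → V} {A : ι → Finset V}
    (hi : ∀ c ∈ s, i c ∈ A c) (u : V → ℝ) (a : ℝ) :
    choiceLogLik s i A (fun k => u k + a) = choiceLogLik s i A u := by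
  refine Finset.sum_congr rfl fun c hc => ?_
  have : ∑ k ∈ A c, Real.exp (u k + a) = Real.exp a * ∑ k ∈ A c, Real.exp (u k) := by
    rw [Finset.mul_sum]
    exact Finset.sum_congr rfl fun k _ => by rw [Real.exp_add, mul_comm]
  rw [this, Real.log_mul (Real.exp_pos a).ne' (sum_exp_pos ⟨_, hi c hc⟩ u).ne', Real.log_exp]
  ring

lemma hasDerivAt_choiceLogLik {s : Finset ι} {i : ι → V} {A : ι → Finset V}
    (hi : ∀ c ∈ s, i c ∈ A c) (u : V → ℝ) (S : Finset V) :
    HasDerivAt (fun t : ℝ => choiceLogLik s i A (fun k => u k + t * if k ∈ S then 1 else 0))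
      (choiceScore s i A u S) 0 := by
  unfold choiceLogLik choiceScore
  refine HasDerivAt.fun_sum fun c hc => ?_
  have hlin : ∀ k, HasDerivAt (fun t : ℝ => u k + t * if k ∈ S then (1 : ℝ) else 0)
      (if k ∈ S then 1 else 0) 0 := by
    intro k
    simpa using ((hasDerivAt_id (0 : ℝ)).mul_const (if k ∈ S then (1 : ℝ) else 0)).const_add (u k)
  refine (hlin (i c)).sub ?_
  have hsum : HasDerivAt
      (fun t : ℝ => ∑ k ∈ A c, Real.exp (u k + t * if k ∈ S then (1 : ℝ) else 0))
      (∑ k ∈ A c, Real.exp (u k + 0 * if k ∈ S then (1 : ℝ) else 0) *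
        if k ∈ S then (1 : ℝ) else 0) 0 :=
    HasDerivAt.fun_sum fun k _ => (hlin k).exp
  have := hsum.log (by simpa using (sum_exp_pos ⟨_, hi c hc⟩ u).ne')
  simp only [mul_ite, mul_one, mul_zero, Finset.sum_ite_mem] at this ⊢
  simpa only [choiceProb, ite_self, add_zero] using this

/-- Indicator directions leave the hyperplane of centered vectors, but by invariance under constants
a centered maximizer is a global one, so these derivatives vanish too. -/
lemma choiceScore_eq_zero_of_isMax [Fintype V] [Nonempty V] {s : Finset ι} {i : ι → V}
    {A : ι → Finset V} (hi : ∀ c ∈ s, i c ∈ A c) {w : V → ℝ}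
    (hw : ∀ v : V → ℝ, ∑ k, v k = 0 → choiceLogLik s i A v ≤ choiceLogLik s i A w)
    (S : Finset V) : choiceScore s i A w S = 0 := by
  have hglobal : ∀ v, choiceLogLik s i A v ≤ choiceLogLik s i A w := by
    intro v
    rw [← choiceLogLik_add_const hi v (-(∑ k, v k) / Fintype.card V)]
    apply hw
    rw [Finset.sum_add_distrib, Finset.sum_const, Finset.card_univ, nsmul_eq_mul]
    field_simp
    ring
  refine IsLocalMax.hasDerivAt_eq_zero ?_ (hasDerivAt_choiceLogLik hi w S)
  refine Filter.Eventually.of_forall fun t => ?_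
  simpa using hglobal _

omit [DecidableEq V] in
lemma continuous_choiceLogLik {s : Finset ι} {i : ι → V} {A : ι → Finset V}
    (hi : ∀ c ∈ s, i c ∈ A c) : Continuous (choiceLogLik s i A) := by
  unfold choiceLogLik
  refine continuous_finsetSum _ fun c hc => (continuous_apply _).sub ?_
  refine Continuous.log (by fun_prop) fun u => (sum_exp_pos ⟨_, hi c hc⟩ u).ne'

-- Every summand of the log-likelihood is nonpositive, so each is bounded by the whole sum. A high
-- likelihood thus prevents a chosen object from lying far below its competitors.
omit [DecidableEq V] in
lemma sub_le_neg_choiceLogLik {s : Finset ι} {i : ι → V} {A : ι → Finset V}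
    (hi : ∀ c ∈ s, i c ∈ A c) (u : V → ℝ) {c : ι} (hc : c ∈ s) {k : V} (hk : k ∈ A c) :
    u k - u (i c) ≤ -choiceLogLik s i A u := by
  have key : ∀ c ∈ s, ∀ k ∈ A c, u k ≤ Real.log (∑ k ∈ A c, Real.exp (u k)) := by
    intro c hc k hk
    rw [Real.le_log_iff_exp_le (sum_exp_pos ⟨_, hk⟩ u)]
    exact Finset.single_le_sum (f := fun k => Real.exp (u k)) (fun _ _ => (Real.exp_pos _).le) hk
  rw [choiceLogLik, ← Finset.sum_neg_distrib]
  refine le_trans ?_ (Finset.single_le_sum (fun c hc => ?_) hc)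
  · linarith [key c hc k hk]
  · linarith [key c hc _ (hi c hc)]

end Choice

/-! ### Growth of superlevel sets -/

section Chain

variable {V : Type*} [Fintype V]

/-- If the superlevel sets of `f` grow by a factor `1 + η` whenever the level is lowered by `g`,
then after `K` steps more than `N` elements are reached, where `N < (1 + η) ^ K`. -/
lemma lt_card_superlevel {f : V → ℝ} {g η N : ℝ} (hg : 0 ≤ g) (hη : 0 ≤ η) {x₀ : V}
    (h : ∀ a ≤ f x₀, ((Finset.univ.filter fun x => a ≤ f x).card : ℝ) ≤ N →
      (1 + η) * (Finset.univ.filter fun x => a ≤ f x).card ≤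
        (Finset.univ.filter fun x => a - g ≤ f x).card) {K : ℕ} (hK : N < (1 + η) ^ K) :
    N < (Finset.univ.filter fun x => f x₀ - K * g ≤ f x).card := by
  have key : ∀ j : ℕ, N < (Finset.univ.filter fun x => f x₀ - j * g ≤ f x).card ∨
      (1 + η) ^ j ≤ (Finset.univ.filter fun x => f x₀ - j * g ≤ f x).card := by
    intro j
    induction j with
    | zero =>
      right
      simp only [pow_zero, Nat.one_le_cast, Nat.cast_zero, zero_mul, sub_zero]
      exact Finset.card_pos.mpr ⟨x₀, by simp⟩
    | succ j ih =>
      have hstep : f x₀ - (j + 1 : ℕ) * g = f x₀ - j * g - g := by push_cast; ring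
      rw [hstep]
      by_cases hN : N < (Finset.univ.filter fun x => f x₀ - j * g ≤ f x).card
      · left
        refine hN.trans_le (Nat.cast_le.mpr (Finset.card_le_card fun x hx => ?_))
        simp only [Finset.mem_filter, Finset.mem_univ, true_and] at hx ⊢
        linarith
      · right
        have h1 := h (f x₀ - j * g) (by nlinarith [Nat.cast_nonneg (α := ℝ) j]) (not_lt.mp hN)
        refine le_trans ?_ h1
        rw [pow_succ']
        exact mul_le_mul_of_nonneg_left (ih.resolve_left hN) (by linarith)
  exact (key K).elim id hK.trans_le

/-- For a centered function, `f x` is the average over `y` of `f x - f y`. -/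
lemma abs_le_of_sum_eq_zero [Nonempty V] {f : V → ℝ} {R : ℝ} (h0 : ∑ x, f x = 0)
    (h : ∀ x y, f x - f y ≤ R) (x : V) : |f x| ≤ R := by
  have hn : (0 : ℝ) < Fintype.card V := by exact_mod_cast Fintype.card_pos
  have hsum : (Fintype.card V : ℝ) * f x = ∑ y, (f x - f y) := by
    rw [Finset.sum_sub_distrib, h0, Finset.sum_const, Finset.card_univ, nsmul_eq_mul, sub_zero]
  rw [abs_le]
  constructor
  · have : ∑ _y : V, (-R) ≤ ∑ y, (f x - f y) :=
      Finset.sum_le_sum fun y _ => by linarith [h y x]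
    rw [Finset.sum_const, Finset.card_univ, nsmul_eq_mul, ← hsum] at this
    exact le_of_mul_le_mul_left this hn
  · have : ∑ y, (f x - f y) ≤ ∑ _y : V, R := Finset.sum_le_sum fun y _ => h x y
    rw [Finset.sum_const, Finset.card_univ, nsmul_eq_mul, ← hsum] at this
    exact le_of_mul_le_mul_left this hn

end Chain

/-! ### Breakings of hypergraphs into choices -/

section Breaking

variable {V ι : Type*} [DecidableEq V]

/-- The edges of `G` having a vertex in `S`. -/
def touching (G : Finset (Finset V)) (S : Finset V) : Finset (Finset V) :=
  G.filter fun T => ∃ x ∈ T, x ∈ S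

/-- The edges of `G` having a vertex in `S` and a vertex outside `S`. -/
def crossing (G : Finset (Finset V)) (S : Finset V) : Finset (Finset V) :=
  G.filter fun T => (∃ x ∈ T, x ∈ S) ∧ ∃ y ∈ T, y ∉ S

lemma mem_crossing {G : Finset (Finset V)} {S T : Finset V} :
    T ∈ crossing G S ↔ T ∈ G ∧ (∃ x ∈ T, x ∈ S) ∧ ∃ y ∈ T, y ∉ S :=
  Finset.mem_filter

lemma crossing_subset (G : Finset (Finset V)) (S : Finset V) : crossing G S ⊆ G :=
  Finset.filter_subset _ _

lemma crossing_compl [Fintype V] (G : Finset (Finset V)) (S : Finset V) :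
    crossing G Sᶜ = crossing G S := by
  ext T
  simp only [crossing, Finset.mem_filter, Finset.mem_compl, not_not]
  tauto

/-- The choices `i c` from `A c`, `c ∈ s`, are extracted from the edges of `G`, the choice `c` from
the edge `e c`, in such a way that any two vertices of an edge compete in some choice. -/
structure IsBreaking (G : Finset (Finset V)) (s : Finset ι) (e : ι → Finset V) (i : ι → V)
    (A : ι → Finset V) : Prop where
  mem : ∀ c ∈ s, i c ∈ A c
  subset : ∀ c ∈ s, A c ⊆ e c
  edge_mem : ∀ c ∈ s, e c ∈ G
  sep : ∀ T ∈ G, ∀ x ∈ T, ∀ y ∈ T, x ≠ y → ∃ c ∈ s, e c = T ∧ x ∈ A c ∧ y ∈ A c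

/-- Each edge of `D` owns a choice worth at least `κ`, and different edges own different choices
because `e` recovers the edge. -/
lemma mul_card_le_sum {s : Finset ι} {e : ι → Finset V} {D : Finset (Finset V)} {f : ι → ℝ}
    {κ : ℝ} (hκ : 0 ≤ κ) (hf : ∀ c ∈ s, 0 ≤ f c) (h : ∀ T ∈ D, ∃ c ∈ s, e c = T ∧ κ ≤ f c) :
    κ * D.card ≤ ∑ c ∈ s, f c := by
  classical
  have hcard : D.card ≤ (s.filter fun c => κ ≤ f c).card := by
    refine (Finset.card_le_card (t := (s.filter fun c => κ ≤ f c).image e) fun T hT => ?_).trans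
      Finset.card_image_le
    obtain ⟨c, hc, hcT, hκc⟩ := h T hT
    exact Finset.mem_image.mpr ⟨c, Finset.mem_filter.mpr ⟨hc, hκc⟩, hcT⟩
  calc κ * D.card ≤ κ * (s.filter fun c => κ ≤ f c).card := by gcongr
    _ = ∑ c ∈ s.filter fun c => κ ≤ f c, κ := by rw [Finset.sum_const, nsmul_eq_mul, mul_comm]
    _ ≤ ∑ c ∈ s.filter fun c => κ ≤ f c, f c :=
        Finset.sum_le_sum fun c hc => (Finset.mem_filter.mp hc).2
    _ ≤ _ := Finset.sum_le_sum_of_subset_of_nonneg (Finset.filter_subset _ _) fun c hc _ => hf c hc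

variable {G : Finset (Finset V)} {s : Finset ι} {e : ι → Finset V} {i : ι → V} {A : ι → Finset V}

lemma choiceScore_sub (u v : V → ℝ) (U : Finset V) :
    choiceScore s i A u U - choiceScore s i A v U =
      ∑ c ∈ s, (choiceProb v (A c) U - choiceProb u (A c) U) := by
  rw [choiceScore, choiceScore, ← Finset.sum_sub_distrib]
  exact Finset.sum_congr rfl fun c _ => by ring

/-- Passing from `u` to `v` raises the probability of `U` in every choice, and by a definite amount
in at least one choice of each edge of `D`; the observed indicators cancel in the difference of
scores. -/
lemma IsBreaking.mul_card_le_score_sub (hb : IsBreaking G s e i A) {m : ℕ}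
    (hm : ∀ T ∈ G, T.card ≤ m) {u v : V → ℝ} {B g : ℝ} (hu : ∀ k, |u k| ≤ B) (hg : 0 ≤ g)
    (hg1 : g ≤ 1) {U : Finset V} (hU : ∀ x ∈ U, ∀ y ∉ U, v y - u y ≤ v x - u x)
    {D : Finset (Finset V)} (hDG : D ⊆ G)
    (hD : ∀ T ∈ D, ∃ x ∈ T, x ∈ U ∧ ∃ y ∈ T, y ∉ U ∧ g ≤ (v x - u x) - (v y - u y)) :
    g / (2 * m ^ 2 * Real.exp (4 * B)) * D.card ≤
      choiceScore s i A u U - choiceScore s i A v U := by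
  rw [choiceScore_sub]
  refine mul_card_le_sum (e := e) (by positivity) (fun c hc => ?_) fun T hT => ?_
  · exact sub_nonneg.mpr (choiceProb_le_choiceProb ⟨_, hb.mem c hc⟩ hU)
  · obtain ⟨x, hxT, hxU, y, hyT, hyU, hxy⟩ := hD T hT
    obtain ⟨c, hc, hcT, hx, hy⟩ := hb.sep T (hDG hT) x hxT y hyT
      (fun h => hyU (h ▸ hxU))
    refine ⟨c, hc, hcT, le_choiceProb_sub hU hu ?_ hg hg1 hx hxU hy hyU hxy⟩
    exact (Finset.card_le_card (hb.subset c hc)).trans (hm _ (hb.edge_mem c hc))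

/-- If no object of `S` were ever chosen over one outside `S`, every term of the score would be
nonpositive, and each crossing edge would have a choice won from outside `S` with an object of `S`
competing. That term is at most minus the lower bound for a choice probability, making the score too
negative. -/
lemma IsBreaking.exists_mem_of_score (hb : IsBreaking G s e i A) {m : ℕ}
    (hm : ∀ T ∈ G, T.card ≤ m) {u : V → ℝ} {B : ℝ} (hu : ∀ k, |u k| ≤ B) {S : Finset V}
    (h : |choiceScore s i A u S| < 1 / (m * Real.exp (2 * B)) * (crossing G S).card) :
    ∃ c ∈ s, i c ∈ S ∧ ∃ k ∈ A c, k ∉ S := by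
  by_contra! hcon
  have hle : 1 / (m * Real.exp (2 * B)) * (crossing G S).card ≤
      ∑ c ∈ s, -((if i c ∈ S then 1 else 0) - choiceProb u (A c) S) := by
    refine mul_card_le_sum (e := e) (by positivity) (fun c hc => ?_) fun T hT => ?_
    · by_cases hic : i c ∈ S
      · rw [if_pos hic, choiceProb_of_subset ⟨_, hb.mem c hc⟩ (hcon c hc hic)]
        norm_num
      · rw [if_neg hic]
        linarith [choiceProb_nonneg u (A c) S]
    · obtain ⟨hTG, ⟨x, hxT, hxS⟩, y, hyT, hyS⟩ := Finset.mem_filter.mp hT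
      obtain ⟨c, hc, hcT, hx, hy⟩ := hb.sep T hTG x hxT y hyT (fun h => hyS (h ▸ hxS))
      refine ⟨c, hc, hcT, ?_⟩
      have hic : i c ∉ S := fun hic => hyS (hcon c hc hic y hy)
      rw [if_neg hic, zero_sub, neg_neg]
      exact le_choiceProb hu ((Finset.card_le_card (hb.subset c hc)).trans
        (hm _ (hb.edge_mem c hc))) ⟨x, Finset.mem_inter.mpr ⟨hx, hxS⟩⟩
  rw [Finset.sum_neg_distrib] at hle
  have := neg_le_abs (choiceScore s i A u S)
  rw [choiceScore] at this h
  linarith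

/-! ### Existence and uniqueness of the maximizer -/

section Existence

variable [Fintype V] [Nonempty V]

/-- Ford's condition implies that the log-likelihood attains its maximum. -/
lemma exists_isMax_choiceLogLik (hi : ∀ c ∈ s, i c ∈ A c)
    (hF : ∀ S : Finset V, S.Nonempty → Sᶜ.Nonempty → ∃ c ∈ s, i c ∉ S ∧ ∃ k ∈ A c, k ∈ S) :
    ∃ w : V → ℝ, ∑ k, w k = 0 ∧
      ∀ v : V → ℝ, ∑ k, v k = 0 → choiceLogLik s i A v ≤ choiceLogLik s i A w := by
  set B := -choiceLogLik s i A 0 with hB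
  have hcont := continuous_choiceLogLik (s := s) (i := i) (A := A) hi
  have hB0 : 0 ≤ B := by
    rw [hB, choiceLogLik, ← Finset.sum_neg_distrib]
    refine Finset.sum_nonneg fun c hc => ?_
    have : (1 : ℝ) ≤ (A c).card := by exact_mod_cast Finset.card_pos.mpr ⟨_, hi c hc⟩
    simpa using Real.log_nonneg this
  have hn : (0 : ℝ) < Fintype.card V := by exact_mod_cast Fintype.card_pos
  -- A factor `1 + 1 / |V|` is what gaining a single element guarantees, and exceeding `|V| - 1`
  -- elements means having all of them.
  obtain ⟨K, hK⟩ := pow_unbounded_of_one_lt ((Fintype.card V : ℝ) - 1)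
    (show (1 : ℝ) < 1 + 1 / Fintype.card V by linarith [one_div_pos.mpr hn])
  -- Ford's condition gives, for a proper superlevel set, an object outside it chosen over one
  -- inside; the likelihood bound puts this object at most `B` lower. So all coordinates are reached
  -- within `K * B`, and the vectors doing at least as well as zero form a compact set after
  -- centering.
  have hosc : ∀ u : V → ℝ, choiceLogLik s i A 0 ≤ choiceLogLik s i A u →
      ∀ x y, u x - u y ≤ K * B := by
    intro u hu x y
    have h := lt_card_superlevel (f := u) (x₀ := x) hB0 (one_div_pos.mpr hn).le ?_ hK
    · have huniv : (Finset.univ.filter fun z => u x - K * B ≤ u z) = Finset.univ := by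
        rw [← Finset.card_eq_iff_eq_univ]
        refine le_antisymm (Finset.card_le_univ _) ?_
        have h2 : (Fintype.card V : ℝ) <
            ((Finset.univ.filter fun z => u x - K * B ≤ u z).card + 1 : ℕ) := by
          push_cast
          linarith
        exact Nat.lt_succ_iff.mp (Nat.cast_lt.mp h2)
      have := Finset.mem_univ y
      rw [← huniv, Finset.mem_filter] at this
      linarith [this.2]
    · intro a ha hcard
      set S := Finset.univ.filter fun z => a ≤ u z with hS
      have hSc : Sᶜ.Nonempty := by
        rw [← Finset.card_pos, Finset.card_compl, Nat.sub_pos_iff_lt]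
        have : (S.card : ℝ) < Fintype.card V := by linarith
        exact_mod_cast this
      obtain ⟨c, hc, hic, k, hk, hkS⟩ := hF S ⟨x, by simp [hS, ha]⟩ hSc
      have hgap := sub_le_neg_choiceLogLik hi u hc hk
      have hka : a ≤ u k := (Finset.mem_filter.mp hkS).2
      have hlt : S.card + 1 ≤ (Finset.univ.filter fun z => a - B ≤ u z).card := by
        rw [← Finset.card_insert_of_notMem hic]
        refine Finset.card_le_card (Finset.insert_subset ?_ fun z hz => ?_)
        · simp only [Finset.mem_filter, Finset.mem_univ, true_and]
          linarith
        · simp only [hS, Finset.mem_filter, Finset.mem_univ, true_and] at hz ⊢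
          linarith
      have hlt' : (S.card : ℝ) + 1 ≤ (Finset.univ.filter fun z => a - B ≤ u z).card := by
        exact_mod_cast hlt
      refine le_trans ?_ hlt'
      have : 1 / (Fintype.card V : ℝ) * S.card ≤ 1 := by
        rw [one_div, inv_mul_le_iff₀ hn]
        linarith
      linarith
  set Z : Set (V → ℝ) := {v | ∑ k, v k = 0 ∧ choiceLogLik s i A 0 ≤ choiceLogLik s i A v} with hZ
  have hZcompact : IsCompact Z := by
    refine Metric.isCompact_of_isClosed_isBounded ?_ ?_
    · exact (isClosed_eq (by fun_prop) continuous_const).inter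
        (isClosed_le continuous_const hcont)
    · refine (Metric.isBounded_closedBall (x := (0 : V → ℝ)) (r := K * B)).subset fun v hv => ?_
      rw [mem_closedBall_zero_iff, pi_norm_le_iff_of_nonneg (by positivity)]
      exact fun x => abs_le_of_sum_eq_zero hv.1 (hosc v hv.2) x
  obtain ⟨w, hw, hmax⟩ := hZcompact.exists_isMaxOn ⟨0, by simp [hZ]⟩ hcont.continuousOn
  refine ⟨w, hw.1, fun v hv => ?_⟩
  by_cases h : choiceLogLik s i A 0 ≤ choiceLogLik s i A v
  · exact hmax ⟨hv, h⟩
  · exact (not_le.mp h).le.trans hw.2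

/-- If `w - v` is not constant, some edge crosses the set where it is maximal, and the scores of
that set at `v` and `w` differ. Constancy and centering give equality. -/
lemma IsBreaking.eq_of_score_eq_zero (hb : IsBreaking G s e i A)
    (hconn : ∀ S : Finset V, S.Nonempty → Sᶜ.Nonempty → (crossing G S).Nonempty) {v w : V → ℝ}
    (hv : ∀ S, choiceScore s i A v S = 0) (hw : ∀ S, choiceScore s i A w S = 0)
    (hv0 : ∑ k, v k = 0) (hw0 : ∑ k, w k = 0) : v = w := by
  obtain ⟨x₀, hx₀⟩ := Finite.exists_max fun x => w x - v x
  have hconst : ∀ y, w y - v y = w x₀ - v x₀ := by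
    by_contra! hne
    obtain ⟨y₀, hy₀⟩ := hne
    set U := Finset.univ.filter fun x => w x₀ - v x₀ ≤ w x - v x with hU
    obtain ⟨T, hT⟩ := hconn U ⟨x₀, by simp [hU]⟩
      ⟨y₀, by
        rw [Finset.mem_compl, hU, Finset.mem_filter, not_and, not_le]
        exact fun _ => lt_of_le_of_ne (hx₀ y₀) hy₀⟩
    obtain ⟨hTG, ⟨x, hxT, hxU⟩, y, hyT, hyU⟩ := Finset.mem_filter.mp hT
    have hUmono : ∀ x ∈ U, ∀ y ∉ U, w y - v y ≤ w x - v x := fun x hx y _ =>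
      (hx₀ y).trans (Finset.mem_filter.mp hx).2
    have hgap : 0 < (w x - v x) - (w y - v y) := by
      have h1 := (Finset.mem_filter.mp hxU).2
      have h2 : w y - v y < w x₀ - v x₀ :=
        not_le.mp fun h => hyU (Finset.mem_filter.mpr ⟨Finset.mem_univ _, h⟩)
      linarith
    have h := hb.mul_card_le_score_sub (m := G.sup Finset.card)
      (fun T hT => Finset.le_sup (f := Finset.card) hT) (B := ‖v‖) (norm_le_pi_norm v)
      (g := min 1 ((w x - v x) - (w y - v y))) (le_min zero_le_one hgap.le) (min_le_left _ _)
      hUmono (D := {T}) (by simpa using hTG) ?_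
    · rw [hv, hw, Finset.card_singleton] at h
      have hm : 0 < G.sup Finset.card :=
        (Finset.card_pos.mpr ⟨x, hxT⟩).trans_le (Finset.le_sup (f := Finset.card) hTG)
      have hm' : (0 : ℝ) < (G.sup Finset.card : ℕ) := by exact_mod_cast hm
      have hpos : 0 < min 1 ((w x - v x) - (w y - v y)) := lt_min zero_lt_one hgap
      have : 0 < min 1 ((w x - v x) - (w y - v y)) /
          (2 * (G.sup Finset.card : ℕ) ^ 2 * Real.exp (4 * ‖v‖)) := by positivity
      simp only [Nat.cast_one, mul_one, sub_zero] at h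
      linarith
    · intro T' hT'
      rw [Finset.mem_singleton] at hT'
      subst hT'
      exact ⟨x, hxT, hxU, y, hyT, hyU, min_le_right _ _⟩
  have hsum : ∑ y, (w y - v y) = Fintype.card V * (w x₀ - v x₀) := by
    rw [Finset.sum_congr rfl fun y _ => hconst y, Finset.sum_const, Finset.card_univ, nsmul_eq_mul]
  rw [Finset.sum_sub_distrib, hv0, hw0, sub_zero] at hsum
  have hn : (Fintype.card V : ℝ) ≠ 0 := by exact_mod_cast Fintype.card_ne_zero
  have h0 : w x₀ - v x₀ = 0 := by
    rcases mul_eq_zero.mp hsum.symm with h | h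
    · exact absurd h hn
    · exact h
  funext y
  linarith [hconst y]

end Existence

/-! ### Deterministic error bound for regular choice data -/

section Error

variable [Fintype V]

/-- The hypergraph `G` expands, has bounded degrees, and the scores at `u` are small. -/
structure IsRegular (G : Finset (Finset V)) (s : Finset ι) (i : ι → V) (A : ι → Finset V)
    (u : V → ℝ) (a b K L : ℝ) : Prop where
  lower : ∀ S : Finset V, S.Nonempty → 2 * S.card ≤ Fintype.card V →
    a * S.card ≤ (crossing G S).card
  upper : ∀ S : Finset V, S.Nonempty → (touching G S).card ≤ b * S.card
  score : ∀ S : Finset V, S.Nonempty →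
    |choiceScore s i A u S| ≤ K * √((crossing G S).card * S.card * L)

variable {u : V → ℝ} {a b K L B g : ℝ}

lemma IsRegular.crossing_nonempty (hr : IsRegular G s i A u a b K L) (ha : 0 < a)
    (S : Finset V) (hS : S.Nonempty) (hSc : Sᶜ.Nonempty) : (crossing G S).Nonempty := by
  have key : ∀ S : Finset V, S.Nonempty → 2 * S.card ≤ Fintype.card V →
      (crossing G S).Nonempty := by
    intro S hS h
    have h1 : 0 < a * S.card := mul_pos ha (by exact_mod_cast Finset.card_pos.mpr hS)
    have h2 := h1.trans_le (hr.lower S hS h)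
    exact Finset.card_pos.mp (by exact_mod_cast h2)
  rcases le_total (2 * S.card) (Fintype.card V) with h | h
  · exact key S hS h
  · rw [← crossing_compl]
    refine key _ hSc ?_
    rw [Finset.card_compl]
    omega

/-- Expansion bounds `|S|` by the number of crossing edges over `a`, turning the square-root bound
into a small fraction of the number of crossing edges. -/
lemma IsRegular.abs_score_le (hr : IsRegular G s i A u a b K L) (ha : 0 < a) (hK : 0 ≤ K)
    {S : Finset V} (hS : S.Nonempty) (h : 2 * S.card ≤ Fintype.card V) :
    |choiceScore s i A u S| ≤ K * √(L / a) * (crossing G S).card := by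
  refine (hr.score S hS).trans ?_
  rw [mul_assoc K]
  refine mul_le_mul_of_nonneg_left ?_ hK
  have hlow := hr.lower S hS h
  have hs : (0 : ℝ) < S.card := by exact_mod_cast Finset.card_pos.mpr hS
  set N : ℝ := ((crossing G S).card : ℝ)
  have hN : 0 < N := (mul_pos ha hs).trans_le hlow
  rcases le_total 0 L with hL | hL
  · rw [Real.sqrt_le_iff]
    refine ⟨by positivity, ?_⟩
    rw [mul_pow, Real.sq_sqrt (by positivity)]
    calc N * S.card * L = L / a * (a * S.card) * N := by field_simp
      _ ≤ L / a * N * N := by gcongr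
      _ = L / a * N ^ 2 := by ring
  · rw [Real.sqrt_eq_zero_of_nonpos (mul_nonpos_of_nonneg_of_nonpos (by positivity) hL)]
    positivity

lemma IsRegular.exists_isMax [Nonempty V] (hb : IsBreaking G s e i A)
    (hr : IsRegular G s i A u a b K L) (ha : 0 < a) (hK : 0 ≤ K) {m : ℕ}
    (hm : ∀ T ∈ G, T.card ≤ m) (hu : ∀ k, |u k| ≤ B)
    (hL : K * √(L / a) < 1 / (m * Real.exp (2 * B))) :
    ∃ w : V → ℝ, ∑ k, w k = 0 ∧
      ∀ v : V → ℝ, ∑ k, v k = 0 → choiceLogLik s i A v ≤ choiceLogLik s i A w := by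
  refine exists_isMax_choiceLogLik hb.mem fun S hS hSc => ?_
  have hlt : ∀ S : Finset V, S.Nonempty → Sᶜ.Nonempty → 2 * S.card ≤ Fintype.card V →
      |choiceScore s i A u S| < 1 / (m * Real.exp (2 * B)) * (crossing G S).card := by
    intro S hS hSc h
    refine (hr.abs_score_le ha hK hS h).trans_lt (mul_lt_mul_of_pos_right hL ?_)
    exact_mod_cast Finset.card_pos.mpr (hr.crossing_nonempty ha S hS hSc)
  -- The regularity bound covers sets with at most half of the vertices; for the others, score (up
  -- to sign) and crossing edges are those of the complement.
  have hlt' : |choiceScore s i A u Sᶜ| < 1 / (m * Real.exp (2 * B)) * (crossing G Sᶜ).card := by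
    rcases le_total (2 * S.card) (Fintype.card V) with h | h
    · rw [choiceScore_compl hb.mem, abs_neg, crossing_compl]
      exact hlt S hS hSc h
    · refine hlt Sᶜ hSc (by rwa [compl_compl]) ?_
      rw [Finset.card_compl]
      omega
  obtain ⟨c, hc, hic, k, hk, hkS⟩ := hb.exists_mem_of_score hm hu hlt'
  exact ⟨c, hc, Finset.mem_compl.mp hic, k, hk, by simpa using hkS⟩

omit [Fintype V] in
lemma touching_crossing_card_le (G : Finset (Finset V)) (S R : Finset V) :
    (crossing G S).card ≤ (touching G R).card + (crossing G S \ touching G R).card := by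
  rw [add_comm]
  exact Finset.card_le_card_sdiff_add_card

/-- Superlevel sets of `f = ±(w - u)` grow geometrically when the level is lowered by `g`. -/
lemma IsRegular.growth (hb : IsBreaking G s e i A) (hr : IsRegular G s i A u a b K L)
    (ha : 0 < a) (hbpos : 0 < b) (hK : 0 ≤ K) {m : ℕ} (hm : ∀ T ∈ G, T.card ≤ m)
    (hu : ∀ k, |u k| ≤ B) (hg : 0 ≤ g) (hg1 : g ≤ 1)
    (hgK : 2 * (K * √(L / a)) < g / (2 * m ^ 2 * Real.exp (4 * B)))
    {w : V → ℝ} (hw : ∀ S, choiceScore s i A w S = 0) {f : V → ℝ}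
    (hf : (∀ x, f x = w x - u x) ∨ ∀ x, f x = -(w x - u x)) {x₀ : V} {t : ℝ} (ht : t ≤ f x₀)
    (hcard : ((Finset.univ.filter fun x => t ≤ f x).card : ℝ) ≤ Fintype.card V / 2) :
    (1 + a / (2 * b)) * (Finset.univ.filter fun x => t ≤ f x).card ≤
      (Finset.univ.filter fun x => t - g ≤ f x).card := by
  set S := Finset.univ.filter fun x => t ≤ f x with hS
  set S' := Finset.univ.filter fun x => t - g ≤ f x with hS'
  have hSne : S.Nonempty := ⟨x₀, by simp [hS, ht]⟩
  have hSS' : S ⊆ S' := by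
    intro x hx
    simp only [hS, hS', Finset.mem_filter, Finset.mem_univ, true_and] at hx ⊢
    linarith
  have hcard2 : 2 * S.card ≤ Fintype.card V := by
    have : (2 * S.card : ℝ) ≤ Fintype.card V := by linarith
    exact_mod_cast this
  have hcardS' : (S'.card : ℝ) = (S' \ S).card + S.card := by
    exact_mod_cast (Finset.card_sdiff_add_card_eq_card hSS').symm
  rw [hcardS']
  suffices h : a / (2 * b) * S.card ≤ (S' \ S).card by linarith
  by_contra! hlt
  have hlow := hr.lower S hSne hcard2
  have hs : (0 : ℝ) < S.card := by exact_mod_cast Finset.card_pos.mpr hSne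
  have hN : (0 : ℝ) < (crossing G S).card := (mul_pos ha hs).trans_le hlow
  -- Crossing edges avoiding the newly added vertices: their endpoints outside `S` lie below level
  -- `t - g`. The assumed smallness of `S' \ S` makes at most half of the crossing edges touch it.
  set D := crossing G S \ touching G (S' \ S) with hD
  have hDcard : ((crossing G S).card : ℝ) / 2 ≤ D.card := by
    have h1 : ((crossing G S).card : ℝ) ≤ (touching G (S' \ S)).card + D.card := by
      exact_mod_cast touching_crossing_card_le G S (S' \ S)
    have h2 : ((touching G (S' \ S)).card : ℝ) ≤ b * (S' \ S).card := by
      rcases (S' \ S).eq_empty_or_nonempty with h0 | h0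
      · rw [h0]
        simp [touching]
      · exact hr.upper _ h0
    have h3 : b * ((S' \ S).card : ℝ) ≤ b * (a / (2 * b) * S.card) := by gcongr
    have h4 : b * (a / (2 * b) * S.card) = a * S.card / 2 := by field_simp
    linarith
  have hDprop : ∀ T ∈ D, ∃ x ∈ T, x ∈ S ∧ ∃ y ∈ T, y ∉ S ∧ g ≤ f x - f y := by
    intro T hT
    obtain ⟨hT1, hT2⟩ := Finset.mem_sdiff.mp hT
    obtain ⟨hTG, ⟨x, hxT, hxS⟩, y, hyT, hyS⟩ := Finset.mem_filter.mp hT1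
    refine ⟨x, hxT, hxS, y, hyT, hyS, ?_⟩
    have hyS' : y ∉ S' := fun hyS' =>
      hT2 (Finset.mem_filter.mpr ⟨hTG, y, hyT, Finset.mem_sdiff.mpr ⟨hyS', hyS⟩⟩)
    have h1 : t ≤ f x := (Finset.mem_filter.mp hxS).2
    have h2 : f y < t - g :=
      not_le.mp fun h => hyS' (Finset.mem_filter.mpr ⟨Finset.mem_univ _, h⟩)
    linarith
  have hDG : D ⊆ G := Finset.sdiff_subset.trans (Finset.filter_subset _ _)
  have hmono : ∀ x ∈ S, ∀ y ∉ S, f y ≤ f x := by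
    intro x hx y hy
    have h1 : t ≤ f x := (Finset.mem_filter.mp hx).2
    have h2 : f y < t := by simpa [hS] using hy
    linarith
  have hscore : g / (2 * m ^ 2 * Real.exp (4 * B)) * D.card ≤ |choiceScore s i A u S| := by
    rcases hf with hf | hf
    · have := hb.mul_card_le_score_sub hm hu hg hg1 (v := w) (U := S)
        (fun x hx y hy => by rw [← hf, ← hf]; exact hmono x hx y hy) hDG
        (fun T hT => by simpa only [← hf] using hDprop T hT)
      rw [hw, sub_zero] at this
      exact this.trans (le_abs_self _)
    -- For `f = -(w - u)` the increments are larger off `S`, so the comparison is made on the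
    -- complement, whose score is the negative.
    · have := hb.mul_card_le_score_sub hm hu hg hg1 (v := w) (U := Sᶜ)
        (fun x hx y hy => by
          have := hmono y (by simpa using hy) x (by simpa using hx)
          rw [hf, hf] at this
          linarith) hDG
        (fun T hT => by
          obtain ⟨x, hxT, hxS, y, hyT, hyS, hxy⟩ := hDprop T hT
          refine ⟨y, hyT, by simpa using hyS, x, hxT, by simpa using hxS, ?_⟩
          rw [hf, hf] at hxy
          linarith)
      rw [hw, sub_zero, choiceScore_compl hb.mem] at this
      exact this.trans (neg_le_abs _)
  have hup := hr.abs_score_le ha hK hSne hcard2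
  have hpos : 0 ≤ g / (2 * m ^ 2 * Real.exp (4 * B)) := by positivity
  have h5 : g / (2 * m ^ 2 * Real.exp (4 * B)) * ((crossing G S).card / 2) ≤
      K * √(L / a) * (crossing G S).card :=
    (mul_le_mul_of_nonneg_left hDcard hpos).trans (hscore.trans hup)
  nlinarith

/-- Descending from `x` and ascending from `y` by `J` steps of size `g` each reaches more than half
of the vertices, so some vertex is reached by both. -/
lemma IsRegular.norm_sub_le [Nonempty V] (hb : IsBreaking G s e i A)
    (hr : IsRegular G s i A u a b K L)
    (ha : 0 < a) (hbpos : 0 < b) (hK : 0 ≤ K) {m : ℕ} (hm : ∀ T ∈ G, T.card ≤ m)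
    (hu : ∀ k, |u k| ≤ B) (hg : 0 ≤ g) (hg1 : g ≤ 1)
    (hgK : 2 * (K * √(L / a)) < g / (2 * m ^ 2 * Real.exp (4 * B))) {J : ℕ}
    (hJ : (Fintype.card V : ℝ) / 2 < (1 + a / (2 * b)) ^ J)
    {w : V → ℝ} (hw : ∀ S, choiceScore s i A w S = 0) (hw0 : ∑ k, w k = 0)
    (hu0 : ∑ k, u k = 0) : ‖w - u‖ ≤ 2 * J * g := by
  have hosc : ∀ x y, (w x - u x) - (w y - u y) ≤ 2 * J * g := by
    intro x y
    have h1 := lt_card_superlevel (f := fun z => w z - u z) (x₀ := x) hg (by positivity)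
      (fun t ht hc => hr.growth hb ha hbpos hK hm hu hg hg1 hgK hw (Or.inl fun _ => rfl) ht hc) hJ
    have h2 := lt_card_superlevel (f := fun z => -(w z - u z)) (x₀ := y) hg (by positivity)
      (fun t ht hc => hr.growth hb ha hbpos hK hm hu hg hg1 hgK hw (Or.inr fun _ => rfl) ht hc) hJ
    have hlt : (Finset.univ : Finset V).card <
        (Finset.univ.filter fun z => w x - u x - J * g ≤ w z - u z).card +
        (Finset.univ.filter fun z => -(w y - u y) - J * g ≤ -(w z - u z)).card := by
      rw [Finset.card_univ]
      have : (Fintype.card V : ℝ) <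
        (Finset.univ.filter fun z => w x - u x - J * g ≤ w z - u z).card +
        (Finset.univ.filter fun z => -(w y - u y) - J * g ≤ -(w z - u z)).card := by linarith
      exact_mod_cast this
    obtain ⟨z, hz⟩ := Finset.inter_nonempty_of_card_lt_card_add_card
      (Finset.filter_subset _ _) (Finset.filter_subset _ _) hlt
    have h3 := (Finset.mem_filter.mp (Finset.mem_inter.mp hz).1).2
    have h4 := (Finset.mem_filter.mp (Finset.mem_inter.mp hz).2).2
    linarith
  rw [pi_norm_le_iff_of_nonneg (by positivity)]
  refine fun x => abs_le_of_sum_eq_zero ?_ hosc x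
  rw [Finset.sum_sub_distrib, hw0, hu0, sub_zero]

end Error

end Breaking

/-! ### Plackett–Luce rankings by recursion on the first object -/

section Recursion

variable {α : Type*} [DecidableEq α]

/-- The ranking of `α` with first element `x`, followed by the ranking `e` of the others. -/
def consRanking {m : ℕ} (x : α) (e : Fin m ≃ {y : α // y ≠ x}) : Fin (m + 1) ≃ α :=
  (finSuccEquiv m).trans ((Equiv.optionSubtype x).symm e)

@[simp] lemma consRanking_zero {m : ℕ} (x : α) (e : Fin m ≃ {y : α // y ≠ x}) :
    consRanking x e 0 = x := by
  simp [consRanking]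

@[simp] lemma consRanking_succ {m : ℕ} (x : α) (e : Fin m ≃ {y : α // y ≠ x}) (j : Fin m) :
    consRanking x e j.succ = e j := by
  simp [consRanking]

lemma sum_ranking_succ [Fintype α] {m : ℕ} (f : (Fin (m + 1) ≃ α) → ℝ) :
    ∑ e, f e = ∑ x, ∑ e : Fin m ≃ {y : α // y ≠ x}, f (consRanking x e) := by
  rw [Finset.sum_sigma', Finset.univ_sigma_univ]
  symm
  refine Fintype.sum_bijective
    (fun p : Σ x : α, Fin m ≃ {y : α // y ≠ x} => consRanking p.1 p.2) ⟨?_, ?_⟩ _ _ fun _ => rfl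
  · rintro ⟨x, e⟩ ⟨x', e'⟩ h
    have hx : x = x' := by simpa using DFunLike.congr_fun h 0
    subst hx
    congr
    ext j
    simpa using DFunLike.congr_fun h j.succ
  · intro e
    refine ⟨⟨e 0, Equiv.optionSubtype (e 0) ⟨(finSuccEquiv m).symm.trans e, by simp⟩⟩, ?_⟩
    simp only [consRanking, Equiv.symm_apply_apply]
    ext j
    simp

lemma sum_Ici_zero {m : ℕ} (f : Fin (m + 1) → ℝ) : ∑ t ∈ Finset.Ici 0, f t = ∑ t, f t := by
  congr 1
  ext t
  simp

lemma sum_Ici_succ {m : ℕ} (j : Fin m) (f : Fin (m + 1) → ℝ) :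
    ∑ t ∈ Finset.Ici j.succ, f t = ∑ t ∈ Finset.Ici j, f t.succ := by
  rw [← Fin.map_succEmb_Ici, Finset.sum_map]
  rfl

/-- Plackett–Luce probability of a ranking, for the weights `v`. -/
noncomputable def plWeight (v : α → ℝ) {m : ℕ} (e : Fin m ≃ α) : ℝ :=
  ∏ j, v (e j) / ∑ t ∈ Finset.Ici j, v (e t)

lemma plWeight_consRanking [Fintype α] (v : α → ℝ) {m : ℕ} (x : α)
    (e : Fin m ≃ {y : α // y ≠ x}) :
    plWeight v (consRanking x e) =
      v x / (∑ y, v y) * plWeight (fun y : {y : α // y ≠ x} => v y) e := by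
  rw [plWeight, Fin.prod_univ_succ, sum_Ici_zero, Equiv.sum_comp (consRanking x e) v,
    consRanking_zero, plWeight]
  congr 1
  refine Finset.prod_congr rfl fun j _ => ?_
  rw [sum_Ici_succ]
  simp only [consRanking_succ]

end Recursion

lemma card_ne_eq {α : Type*} [DecidableEq α] [Fintype α] {m : ℕ} (hα : Fintype.card α = m + 1)
    (x : α) : Fintype.card {y : α // y ≠ x} = m := by
  rw [Fintype.card_subtype_compl, Fintype.card_subtype_eq, hα, Nat.add_sub_cancel]

lemma sum_pos_of_card {α : Type*} [Fintype α] {m : ℕ} (hα : Fintype.card α = m + 1)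
    {v : α → ℝ} (hv : ∀ x, 0 < v x) : 0 < ∑ x, v x := by
  have : Nonempty α := Fintype.card_pos_iff.mp (by omega)
  exact Finset.sum_pos (fun x _ => hv x) Finset.univ_nonempty

lemma sum_plWeight : ∀ {m : ℕ} {α : Type} [DecidableEq α] [Fintype α],
    Fintype.card α = m → ∀ {v : α → ℝ}, (∀ x, 0 < v x) → ∑ e : Fin m ≃ α, plWeight v e = 1 := by
  intro m
  induction m with
  | zero =>
    intro α _ _ hα v hv
    have : IsEmpty α := Fintype.card_eq_zero_iff.mp hα
    have : Unique (Fin 0 ≃ α) := ⟨⟨Equiv.equivOfIsEmpty _ _⟩, fun e => by ext j; exact j.elim0⟩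
    rw [Fintype.sum_unique]
    simp [plWeight]
  | succ m ih =>
    intro α _ _ hα v hv
    rw [sum_ranking_succ]
    simp only [plWeight_consRanking, ← Finset.mul_sum]
    rw [Finset.sum_congr rfl fun x _ => by rw [ih (card_ne_eq hα x) fun y => hv y, mul_one],
      ← Finset.sum_div, div_self (sum_pos_of_card hα hv).ne']

/-- The choice at stage `j` of a Plackett–Luce ranking follows Luce's rule. -/
lemma sum_plWeight_mul_stage : ∀ {m : ℕ} {α : Type} [DecidableEq α] [Fintype α],
    Fintype.card α = m → ∀ {v : α → ℝ}, (∀ x, 0 < v x) → ∀ (φ : α → ℝ) (j : Fin m),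
    ∑ e : Fin m ≃ α, plWeight v e *
      (φ (e j) - (∑ t ∈ Finset.Ici j, φ (e t) * v (e t)) / ∑ t ∈ Finset.Ici j, v (e t)) = 0 := by
  intro m
  induction m with
  | zero => intro α _ _ _ v _ φ j; exact j.elim0
  | succ m ih =>
    intro α _ _ hα v hv φ j
    rw [sum_ranking_succ]
    have hV := sum_pos_of_card hα hv
    refine Fin.cases ?_ (fun j => ?_) j
    · simp only [sum_Ici_zero]
      have : ∀ (x : α) (e : Fin m ≃ {y : α // y ≠ x}), plWeight v (consRanking x e) *
          (φ (consRanking x e 0) - (∑ t, φ (consRanking x e t) * v (consRanking x e t)) /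
            ∑ t, v (consRanking x e t)) =
          plWeight (fun y : {y : α // y ≠ x} => v y) e *
            (v x / (∑ y, v y) * (φ x - (∑ y, φ y * v y) / ∑ y, v y)) := by
        intro x e
        rw [plWeight_consRanking, Equiv.sum_comp (consRanking x e) (fun y => φ y * v y),
          Equiv.sum_comp (consRanking x e) v, consRanking_zero]
        ring
      simp only [this, ← Finset.sum_mul]
      rw [Finset.sum_congr rfl fun x _ => by
        rw [sum_plWeight (card_ne_eq hα x) fun y => hv y, one_mul]]
      have h2 : ∀ x, v x / (∑ y, v y) * (φ x - (∑ y, φ y * v y) / ∑ y, v y) =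
          (φ x * v x - v x * ((∑ y, φ y * v y) / ∑ y, v y)) / ∑ y, v y := by
        intro x; ring
      simp only [h2]
      rw [← Finset.sum_div, Finset.sum_sub_distrib, ← Finset.sum_mul, mul_div_cancel₀ _ hV.ne',
        sub_self, zero_div]
    · refine Finset.sum_eq_zero fun x _ => ?_
      simp only [sum_Ici_succ, consRanking_succ, plWeight_consRanking, mul_assoc]
      rw [← Finset.mul_sum, ih (card_ne_eq hα x) (fun y => hv y) (fun y => φ y) j, mul_zero]

/-- The pairwise comparisons induced by a Plackett–Luce ranking follow Luce's rule. -/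
lemma sum_plWeight_mul_pairs : ∀ {m : ℕ} {α : Type} [DecidableEq α] [Fintype α],
    Fintype.card α = m → ∀ {v : α → ℝ}, (∀ x, 0 < v x) → ∀ φ : α → ℝ,
    ∑ e : Fin m ≃ α, plWeight v e * ∑ j, ∑ t ∈ Finset.Ioi j,
      (φ (e j) - (φ (e j) * v (e j) + φ (e t) * v (e t)) / (v (e j) + v (e t))) = 0 := by
  intro m
  induction m with
  | zero => intro α _ _ _ v _ φ; simp
  | succ m ih =>
    intro α _ _ hα v hv φ
    rw [sum_ranking_succ]
    set h : α → α → ℝ := fun x y => φ x - (φ x * v x + φ y * v y) / (v x + v y) with hh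
    have hstep : ∀ (x : α) (e : Fin m ≃ {y : α // y ≠ x}),
        plWeight v (consRanking x e) * ∑ j, ∑ t ∈ Finset.Ioi j,
          h (consRanking x e j) (consRanking x e t) =
        plWeight (fun y : {y : α // y ≠ x} => v y) e *
          (v x / (∑ y, v y) * ∑ y : {y : α // y ≠ x}, h x y) +
        v x / (∑ y, v y) * (plWeight (fun y : {y : α // y ≠ x} => v y) e *
          ∑ j, ∑ t ∈ Finset.Ioi j, h (e j) (e t)) := by
      intro x e
      rw [plWeight_consRanking, Fin.sum_univ_succ, Fin.sum_Ioi_zero]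
      simp only [Fin.sum_Ioi_succ, consRanking_succ, consRanking_zero]
      rw [Equiv.sum_comp e (fun y : {y : α // y ≠ x} => h x y)]
      ring
    change ∑ x, ∑ e : Fin m ≃ {y : α // y ≠ x}, plWeight v (consRanking x e) *
      ∑ j, ∑ t ∈ Finset.Ioi j, h (consRanking x e j) (consRanking x e t) = 0
    simp only [hstep, Finset.sum_add_distrib, ← Finset.sum_mul, ← Finset.mul_sum]
    have h2 : ∀ x, ∑ e : Fin m ≃ {y : α // y ≠ x}, plWeight (fun y : {y : α // y ≠ x} => v y) e *
        ∑ j, ∑ t ∈ Finset.Ioi j, h (e j) (e t) = 0 := fun x =>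
      ih (card_ne_eq hα x) (fun y => hv y) (fun y => φ y)
    simp only [h2, mul_zero, Finset.sum_const_zero, add_zero]
    have h3 : ∀ x, v x / (∑ y, v y) * ∑ y : {y : α // y ≠ x}, h x y =
        ∑ y, v x / (∑ y, v y) * h x y := by
      intro x
      have hxx : h x x = 0 := by
        have := hv x
        simp only [hh]
        field_simp
        ring
      rw [← Finset.mul_sum, ← Finset.add_sum_erase Finset.univ (h x) (Finset.mem_univ x), hxx, zero_add]
      congr 1
      rw [← Finset.sum_subtype (Finset.univ.erase x) (by simp) (fun y => h x y)]
    rw [Finset.sum_congr rfl fun x _ => by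
      rw [sum_plWeight (card_ne_eq hα x) fun y => hv y, one_mul, h3]]
    -- The weighted term `v x * h x y` equals `v x * v y * (φ x - φ y) / (v x + v y)`. This
    -- antisymmetry cancels the comparisons of the first object with all others; the remaining pairs
    -- are handled by induction.
    have hanti : ∀ x y, v x / (∑ y, v y) * h x y = -(v y / (∑ y, v y) * h y x) := by
      intro x y
      have hx := hv x
      have hy := hv y
      have hV := sum_pos_of_card hα hv
      have hxy : v x + v y ≠ 0 := by positivity
      have hyx : v y + v x ≠ 0 := by positivity
      simp only [hh]
      rw [add_comm (v y) (v x)]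
      field_simp
      ring
    have hswap : ∑ x, ∑ y, v x / (∑ y, v y) * h x y =
        -∑ x, ∑ y, v x / (∑ y, v y) * h x y := by
      conv_lhs => rw [Finset.sum_comm]
      rw [← Finset.sum_neg_distrib]
      refine Finset.sum_congr rfl fun x _ => ?_
      rw [← Finset.sum_neg_distrib]
      exact Finset.sum_congr rfl fun y _ => hanti y x
    linarith

/-! ### Conditional concentration of sums over ranked edges -/

section Hoeffding

/-- By convexity the exponential lies below its chord on `[-b, b]`; centering kills the linear part
and leaves `cosh (r * b)`. -/
lemma sum_mul_exp_le {α : Type*} [Fintype α] {q X : α → ℝ} {b : ℝ} (hq : ∀ a, 0 ≤ q a)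
    (hq1 : ∑ a, q a = 1) (hb : 0 < b) (hX : ∀ a, |X a| ≤ b) (hmean : ∑ a, q a * X a = 0) (r : ℝ) :
    ∑ a, q a * Real.exp (r * X a) ≤ Real.exp ((r * b) ^ 2 / 2) := by
  have hconv : ∀ a, Real.exp (r * X a) ≤
      Real.cosh (r * b) + X a * (Real.sinh (r * b) / b) := by
    intro a
    have h1 := (abs_le.mp (hX a)).1
    have h2 := (abs_le.mp (hX a)).2
    have h := convexOn_exp.2 (Set.mem_univ (r * b)) (Set.mem_univ (-(r * b)))
      (show 0 ≤ (b + X a) / (2 * b) from div_nonneg (by linarith) (by linarith))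
      (show 0 ≤ (b - X a) / (2 * b) from div_nonneg (by linarith) (by linarith))
      (by field_simp; ring)
    simp only [smul_eq_mul] at h
    have h3 : (b + X a) / (2 * b) * (r * b) + (b - X a) / (2 * b) * -(r * b) = r * X a := by
      field_simp
      ring
    rw [h3] at h
    refine h.trans_eq ?_
    rw [Real.cosh_eq, Real.sinh_eq]
    field_simp
    ring
  calc ∑ a, q a * Real.exp (r * X a)
      ≤ ∑ a, q a * (Real.cosh (r * b) + X a * (Real.sinh (r * b) / b)) :=
        Finset.sum_le_sum fun a _ => mul_le_mul_of_nonneg_left (hconv a) (hq a)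
    _ = (∑ a, q a) * Real.cosh (r * b) + (∑ a, q a * X a) * (Real.sinh (r * b) / b) := by
        rw [Finset.sum_mul, Finset.sum_mul, ← Finset.sum_add_distrib]
        exact Finset.sum_congr rfl fun a _ => by ring
    _ = Real.cosh (r * b) := by rw [hq1, hmean]; ring
    _ ≤ _ := Real.cosh_le_exp_half_sq _

variable {Ω : Type*} [MeasurableSpace Ω] {P : Measure Ω} [IsProbabilityMeasure P] {n : ℕ}
  {u : Fin n → ℝ} {E : Ω → Finset (Finset (Fin n))} {π : Ω → ∀ T : Finset (Fin n), Ranking T}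

lemma plProb_nonneg {T : Finset (Fin n)} (σ : Ranking T) : 0 ≤ plProb u σ :=
  Finset.prod_nonneg fun _ _ =>
    div_nonneg (Real.exp_pos _).le (Finset.sum_nonneg fun _ _ => (Real.exp_pos _).le)

lemma plProb_eq_plWeight {T : Finset (Fin n)} (σ : Ranking T) :
    plProb u σ = plWeight (fun k : T => Real.exp (u k)) σ := rfl

lemma sum_plProb (T : Finset (Fin n)) : ∑ σ : Ranking T, plProb u σ = 1 :=
  sum_plWeight (Fintype.card_coe T) fun k : T => Real.exp_pos (u k)

/-- Exponential Markov inequality, carried out as a finite sum over the rankings of the edges of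
`G`. Edges off `D` contribute a factor one, so the variance proxy is `b ^ 2 * |D|`. -/
lemma IsPLSample.tail (hπ : IsPLSample P u E π) (G : Finset (Finset (Fin n)))
    {X : ∀ T : Finset (Fin n), Ranking T → ℝ} {D : Finset (Finset (Fin n))} (hDG : D ⊆ G)
    (hX0 : ∀ T ∈ G, T ∉ D → ∀ σ, X T σ = 0) {b : ℝ} (hb : 0 < b)
    (hXb : ∀ T ∈ D, ∀ σ, |X T σ| ≤ b) (hXm : ∀ T ∈ D, ∑ σ, plProb u σ * X T σ = 0)
    {t : ℝ} (ht : 0 ≤ t) (hD : D.Nonempty) :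
    P.real {ω | E ω = G ∧ t ≤ ∑ T ∈ G, X T (π ω T)} ≤
      P.real {ω | E ω = G} * Real.exp (-(t ^ 2 / (2 * b ^ 2 * D.card))) := by
  classical
  have hN : (0 : ℝ) < D.card := by exact_mod_cast Finset.card_pos.mpr hD
  -- The minimizer of `-r * t + |D| * (r * b) ^ 2 / 2`.
  set r := t / (b ^ 2 * D.card) with hr
  have hr0 : 0 ≤ r := by positivity
  -- Rankings of edges outside `G` are irrelevant, and an arbitrary one is filled in there.
  set ext : (∀ T : G, Ranking (T : Finset (Fin n))) → ∀ T : Finset (Fin n), Ranking T :=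
    fun σ T => if h : T ∈ G then σ ⟨T, h⟩ else T.equivFin.symm with hext
  have hext' : ∀ σ (T : G), ext σ T = σ T := fun σ T => by simp [hext]
  set F : Finset (∀ T : G, Ranking (T : Finset (Fin n))) :=
    Finset.univ.filter fun σ => t ≤ ∑ T ∈ G, X T (ext σ T) with hF
  have hsub : {ω | E ω = G ∧ t ≤ ∑ T ∈ G, X T (π ω T)} ⊆
      ⋃ σ ∈ F, {ω | E ω = G ∧ ∀ T ∈ G, π ω T = ext σ T} := by
    rintro ω ⟨hω, hωt⟩
    have hπext : ∀ T ∈ G, π ω T = ext (fun T => π ω T) T := fun T hT => by simp [hext, hT]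
    simp only [Set.mem_iUnion]
    refine ⟨fun T => π ω T, ?_, hω, hπext⟩
    rw [hF, Finset.mem_filter]
    refine ⟨Finset.mem_univ _, hωt.trans_eq (Finset.sum_congr rfl fun T hT => ?_)⟩
    rw [← hπext T hT]
  have hprod : ∏ T : G, ∑ σ, plProb u σ * Real.exp (r * X T σ) ≤
      Real.exp (D.card * ((r * b) ^ 2 / 2)) := by
    rw [Finset.prod_coe_sort G fun T => ∑ σ, plProb u σ * Real.exp (r * X T σ),
      ← Finset.prod_sdiff hDG]
    have h1 : ∏ T ∈ G \ D, ∑ σ, plProb u σ * Real.exp (r * X T σ) = 1 := by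
      refine Finset.prod_eq_one fun T hT => ?_
      obtain ⟨hTG, hTD⟩ := Finset.mem_sdiff.mp hT
      simp only [hX0 T hTG hTD, mul_zero, Real.exp_zero, mul_one]
      exact sum_plProb T
    rw [h1, one_mul, Real.exp_nat_mul]
    rw [← Finset.prod_const]
    refine Finset.prod_le_prod (fun T _ => Finset.sum_nonneg fun σ _ =>
      mul_nonneg (plProb_nonneg σ) (Real.exp_pos _).le) fun T hT => ?_
    exact sum_mul_exp_le plProb_nonneg (sum_plProb T) hb (hXb T hT) (hXm T hT) r
  have hexp : ∀ σ : ∀ T : G, Ranking (T : Finset (Fin n)),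
      Real.exp (r * (∑ T ∈ G, X T (ext σ T))) = ∏ T : G, Real.exp (r * X T (σ T)) := by
    intro σ
    rw [← Real.exp_sum, Finset.mul_sum, ← Finset.sum_coe_sort G]
    simp only [hext']
  calc P.real {ω | E ω = G ∧ t ≤ ∑ T ∈ G, X T (π ω T)}
      ≤ ∑ σ ∈ F, P.real {ω | E ω = G ∧ ∀ T ∈ G, π ω T = ext σ T} :=
        (measureReal_mono hsub (measure_ne_top _ _)).trans (measureReal_biUnion_finset_le _ _)
    _ = ∑ σ ∈ F, P.real {ω | E ω = G} * ∏ T : G, plProb u (σ T) := by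
        refine Finset.sum_congr rfl fun σ _ => ?_
        rw [hπ.law, ← Finset.prod_coe_sort G]
        simp only [hext']
    _ ≤ ∑ σ ∈ F, P.real {ω | E ω = G} * (∏ T : G, plProb u (σ T)) *
          (Real.exp (-(r * t)) * ∏ T : G, Real.exp (r * X T (σ T))) := by
        refine Finset.sum_le_sum fun σ hσ => le_mul_of_one_le_right
          (mul_nonneg measureReal_nonneg (Finset.prod_nonneg fun _ _ => plProb_nonneg _)) ?_
        rw [← hexp, ← Real.exp_add, Real.one_le_exp_iff]
        have := mul_le_mul_of_nonneg_left (Finset.mem_filter.mp hσ).2 hr0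
        linarith
    _ ≤ ∑ σ : ∀ T : G, Ranking (T : Finset (Fin n)),
          P.real {ω | E ω = G} * (∏ T : G, plProb u (σ T)) *
          (Real.exp (-(r * t)) * ∏ T : G, Real.exp (r * X T (σ T))) :=
        Finset.sum_le_sum_of_subset_of_nonneg (Finset.subset_univ _) fun σ _ _ =>
          mul_nonneg (mul_nonneg measureReal_nonneg (Finset.prod_nonneg fun _ _ => plProb_nonneg _))
            (mul_nonneg (Real.exp_pos _).le (Finset.prod_nonneg fun _ _ => (Real.exp_pos _).le))
    _ = P.real {ω | E ω = G} * (Real.exp (-(r * t)) *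
          ∏ T : G, ∑ σ, plProb u σ * Real.exp (r * X T σ)) := by
        rw [Finset.prod_univ_sum, Fintype.piFinset_univ, Finset.mul_sum, Finset.mul_sum]
        refine Finset.sum_congr rfl fun σ _ => ?_
        rw [Finset.prod_mul_distrib]
        ring
    _ ≤ P.real {ω | E ω = G} * (Real.exp (-(r * t)) * Real.exp (D.card * ((r * b) ^ 2 / 2))) := by
        gcongr
    _ = _ := by
        rw [← Real.exp_add]
        congr 2
        rw [hr]
        field_simp
        ring

lemma measurableSet_edgeSet_eq (hE : ∀ e, MeasurableSet {ω | e ∈ E ω})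
    (G : Finset (Finset (Fin n))) : MeasurableSet {ω | E ω = G} := by
  have : {ω | E ω = G} = ⋂ e, {ω | e ∈ E ω ↔ e ∈ G} := by
    ext ω
    simp [Finset.ext_iff]
  rw [this]
  refine MeasurableSet.iInter fun e => ?_
  by_cases h : e ∈ G
  · simpa [h] using hE e
  · simpa [h, Set.compl_def] using (hE e).compl

lemma sum_measureReal_edgeSet_eq (hE : ∀ e, MeasurableSet {ω | e ∈ E ω}) :
    ∑ G, P.real {ω | E ω = G} = 1 := by
  rw [← measureReal_biUnion_finset]
  · have : ⋃ G ∈ (Finset.univ : Finset (Finset (Finset (Fin n)))), {ω | E ω = G} = Set.univ := by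
      ext ω
      simp
    rw [this, probReal_univ]
  · intro G _ G' _ hne
    exact Set.disjoint_left.mpr fun ω h h' => hne (h.symm.trans h')
  · exact fun G _ => measurableSet_edgeSet_eq hE G

/-- Hoeffding's inequality for sums, over the edges, of centered functions of the rankings. -/
lemma IsPLSample.abs_tail (hπ : IsPLSample P u E π) (hE : ∀ e, MeasurableSet {ω | e ∈ E ω})
    {X : Finset (Finset (Fin n)) → ∀ T : Finset (Fin n), Ranking T → ℝ}
    {D : Finset (Finset (Fin n)) → Finset (Finset (Fin n))} (hDG : ∀ G, D G ⊆ G)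
    (hX0 : ∀ G, ∀ T ∈ G, T ∉ D G → ∀ σ, X G T σ = 0) {b : ℝ} (hb : 0 < b)
    (hXb : ∀ ω, ∀ T ∈ E ω, ∀ σ, |X (E ω) T σ| ≤ b)
    (hXm : ∀ G T, ∑ σ, plProb u σ * X G T σ = 0) {q : ℝ} (hq : 0 ≤ q) :
    P.real {ω | b * √(2 * q * (D (E ω)).card) < |∑ T ∈ E ω, X (E ω) T (π ω T)|} ≤
      2 * Real.exp (-q) := by
  have key : ∀ G, P.real {ω | E ω = G ∧ b * √(2 * q * (D G).card) < |∑ T ∈ G, X G T (π ω T)|} ≤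
      P.real {ω | E ω = G} * (2 * Real.exp (-q)) := by
    intro G
    -- The bound on `X` holds only for edge sets that occur, since only their edges have controlled
    -- size.
    by_cases hG : ∃ ω, E ω = G
    swap
    · push Not at hG
      simp [hG]
    obtain ⟨ω₀, rfl⟩ := hG
    set G := E ω₀
    rcases (D G).eq_empty_or_nonempty with hD | hD
    · have hempty : {ω | E ω = G ∧ b * √(2 * q * (D G).card) < |∑ T ∈ G, X G T (π ω T)|} = ∅ := by
        ext ω
        simp only [Set.mem_ofPred_eq, Set.mem_empty_iff_false, iff_false, not_and]
        intro _
        rw [Finset.sum_eq_zero fun T hT => hX0 G T hT (by simp [hD]) _]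
        simp [hD]
      rw [hempty, measureReal_empty]
      positivity
    · have ht : 0 ≤ b * √(2 * q * (D G).card) := by positivity
      have hN : (0 : ℝ) < (D G).card := by exact_mod_cast Finset.card_pos.mpr hD
      have hexp : (b * √(2 * q * (D G).card)) ^ 2 / (2 * b ^ 2 * (D G).card) = q := by
        rw [mul_pow, Real.sq_sqrt (by positivity)]
        field_simp
      have h1 := hπ.tail G (hDG G) (hX0 G) hb (fun T hT => hXb ω₀ T (hDG G hT))
        (fun T _ => hXm G T) ht hD
      have h2 := hπ.tail G (X := fun T σ => -X G T σ) (hDG G)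
        (fun T hT hTD σ => by rw [hX0 G T hT hTD, neg_zero]) hb
        (fun T hT σ => by rw [abs_neg]; exact hXb ω₀ T (hDG G hT) σ)
        (fun T _ => by simp only [mul_neg, Finset.sum_neg_distrib, hXm G T, neg_zero]) ht hD
      rw [hexp] at h1 h2
      have hsub : {ω | E ω = G ∧ b * √(2 * q * (D G).card) < |∑ T ∈ G, X G T (π ω T)|} ⊆
          {ω | E ω = G ∧ b * √(2 * q * (D G).card) ≤ ∑ T ∈ G, X G T (π ω T)} ∪
          {ω | E ω = G ∧ b * √(2 * q * (D G).card) ≤ ∑ T ∈ G, -X G T (π ω T)} := by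
        rintro ω ⟨hω, h⟩
        rcases lt_abs.mp h with h | h
        · exact Or.inl ⟨hω, h.le⟩
        · exact Or.inr ⟨hω, by rw [Finset.sum_neg_distrib]; exact h.le⟩
      have := (measureReal_mono hsub (μ := P)).trans (measureReal_union_le _ _)
      linarith
  have hsub : {ω | b * √(2 * q * (D (E ω)).card) < |∑ T ∈ E ω, X (E ω) T (π ω T)|} ⊆
      ⋃ G ∈ (Finset.univ : Finset (Finset (Finset (Fin n)))),
        {ω | E ω = G ∧ b * √(2 * q * (D G).card) < |∑ T ∈ G, X G T (π ω T)|} := by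
    intro ω hω
    simpa using hω
  refine (measureReal_mono hsub (measure_ne_top _ _)).trans ((measureReal_biUnion_finset_le _ _).trans ?_)
  refine (Finset.sum_le_sum fun G _ => key G).trans_eq ?_
  rw [← Finset.sum_mul, sum_measureReal_edgeSet_eq hE, one_mul]

end Hoeffding

/-! ### Chernoff bounds for sums of independent indicators -/

section Bernoulli

variable {Ω : Type*} [MeasurableSpace Ω] {P : Measure Ω} [IsProbabilityMeasure P]

lemma mgf_indicator_one {s : Set Ω} (hs : MeasurableSet s) (t : ℝ) :
    mgf (s.indicator fun _ => (1 : ℝ)) P t = 1 + P.real s * (Real.exp t - 1) := by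
  have : ∀ ω, Real.exp (t * s.indicator (fun _ => (1 : ℝ)) ω) =
      1 + s.indicator (fun _ => Real.exp t - 1) ω := by
    intro ω
    by_cases h : ω ∈ s <;> simp [h]
  rw [mgf]
  simp only [this]
  rw [integral_add (integrable_const _) ((integrable_const _).indicator hs),
    integral_indicator_const _ hs]
  simp

lemma mgf_sum_indicator_le {κ : Type*} {s : κ → Set Ω} (hs : ∀ i, MeasurableSet (s i))
    (hind : iIndepSet s P) (F : Finset κ) (t : ℝ) :
    mgf (∑ i ∈ F, (s i).indicator fun _ => (1 : ℝ)) P t ≤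
      Real.exp ((Real.exp t - 1) * ∑ i ∈ F, P.real (s i)) := by
  rw [(hind.iIndepFun_indicator (β := ℝ)).mgf_sum
    (fun i => measurable_const.indicator (hs i)), Finset.mul_sum, Real.exp_sum]
  refine Finset.prod_le_prod (fun i _ => mgf_nonneg) fun i _ => ?_
  rw [mgf_indicator_one (hs i)]
  linarith [Real.add_one_le_exp ((Real.exp t - 1) * P.real (s i))]

lemma integrable_exp_mul_sum_indicator {κ : Type*} {s : κ → Set Ω}
    (hs : ∀ i, MeasurableSet (s i)) (F : Finset κ) (t : ℝ) :
    Integrable (fun ω => Real.exp (t * (∑ i ∈ F, (s i).indicator fun _ => (1 : ℝ)) ω)) P := by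
  have hmeas : Measurable (∑ i ∈ F, (s i).indicator fun _ => (1 : ℝ)) := by
    have h := Finset.measurable_sum F fun i _ =>
      (measurable_const (a := (1 : ℝ))).indicator (hs i)
    convert h using 1
    ext ω
    exact Finset.sum_apply _ _ _
  refine Integrable.of_bound (C := Real.exp (|t| * F.card))
    (Real.measurable_exp.comp (hmeas.const_mul t)).aestronglyMeasurable
    (Eventually.of_forall fun ω => ?_)
  rw [Real.norm_eq_abs, Real.abs_exp, Real.exp_le_exp]
  refine (le_abs_self _).trans ?_
  rw [abs_mul]
  refine mul_le_mul_of_nonneg_left ?_ (abs_nonneg t)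
  rw [Finset.sum_apply]
  refine (Finset.abs_sum_le_sum_abs _ _).trans ?_
  rw [Finset.card_eq_sum_ones, Nat.cast_sum]
  refine Finset.sum_le_sum fun i _ => ?_
  by_cases h : ω ∈ s i <;> simp [h]

lemma measure_four_mul_le_sum_indicator {κ : Type*} {s : κ → Set Ω}
    (hs : ∀ i, MeasurableSet (s i)) (hind : iIndepSet s P) (F : Finset κ) {μ : ℝ}
    (hμ : ∑ i ∈ F, P.real (s i) ≤ μ) :
    P.real {ω | 4 * μ ≤ (∑ i ∈ F, (s i).indicator fun _ => (1 : ℝ)) ω} ≤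
      Real.exp (-(2 * μ)) := by
  have h0 : 0 ≤ ∑ i ∈ F, P.real (s i) := Finset.sum_nonneg fun _ _ => measureReal_nonneg
  refine (measure_ge_le_exp_mul_mgf (4 * μ) zero_le_one
    (integrable_exp_mul_sum_indicator hs F 1)).trans ?_
  refine (mul_le_mul_of_nonneg_left (mgf_sum_indicator_le hs hind F 1)
    (Real.exp_pos _).le).trans ?_
  rw [← Real.exp_add, Real.exp_le_exp]
  -- The exponent is at most `-4 μ + (e - 1) μ`, and `e < 3`.
  nlinarith [Real.exp_one_lt_d9, Real.exp_one_gt_d9]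

lemma measure_sum_indicator_le_div_four {κ : Type*} {s : κ → Set Ω}
    (hs : ∀ i, MeasurableSet (s i)) (hind : iIndepSet s P) (F : Finset κ) {μ : ℝ} (hμ0 : 0 ≤ μ)
    (hμ : μ ≤ ∑ i ∈ F, P.real (s i)) :
    P.real {ω | (∑ i ∈ F, (s i).indicator fun _ => (1 : ℝ)) ω ≤ μ / 4} ≤
      Real.exp (-(μ / 4)) := by
  refine (measure_le_le_exp_mul_mgf (μ / 4) (t := -1) (by norm_num)
    (integrable_exp_mul_sum_indicator hs F (-1))).trans ?_
  refine (mul_le_mul_of_nonneg_left (mgf_sum_indicator_le hs hind F (-1))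
    (Real.exp_pos _).le).trans ?_
  rw [← Real.exp_add, Real.exp_le_exp]
  -- With this the exponent is at most `μ / 4 - μ / 2`.
  have h : Real.exp (-1) ≤ 1 / 2 := by
    rw [Real.exp_neg, one_div]
    exact inv_anti₀ two_pos (by linarith [Real.exp_one_gt_d9])
  nlinarith

end Bernoulli

/-- Borel–Cantelli, after discarding the finitely many indices where the bound may fail. -/
lemma ae_eventually_notMem_of_le {Ω : Type*} [MeasurableSpace Ω] {P : Measure Ω}
    [IsProbabilityMeasure P] {bad : ℕ → Set Ω} {C : ℝ}
    (h : ∀ᶠ n : ℕ in atTop, P.real (bad n) ≤ C / (n : ℝ) ^ 2) :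
    ∀ᵐ ω ∂P, ∀ᶠ n in atTop, ω ∉ bad n := by
  obtain ⟨N, hN⟩ := eventually_atTop.mp h
  have hsum : Summable fun n : ℕ => C / ((n + N : ℕ) : ℝ) ^ 2 := by
    have := (Real.summable_one_div_nat_pow.mpr one_lt_two).mul_left C
    simp only [mul_one_div] at this
    exact (summable_nat_add_iff N).mpr this
  have hfin : ∑' n, P (bad (n + N)) ≠ ⊤ := by
    refine ne_top_of_le_ne_top hsum.tsum_ofReal_ne_top (ENNReal.tsum_le_tsum fun n => ?_)
    rw [← ofReal_measureReal]
    exact ENNReal.ofReal_le_ofReal (hN _ (Nat.le_add_left _ _))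
  filter_upwards [ae_eventually_notMem hfin] with ω hω
  obtain ⟨n₀, hn₀⟩ := eventually_atTop.mp hω
  refine eventually_atTop.mpr ⟨n₀ + N, fun n hn => ?_⟩
  have := hn₀ (n - N) (by omega)
  rwa [Nat.sub_add_cancel (by omega)] at this

/-! ### Counting crossing and touching edges -/

section Counting

variable {n : ℕ}

/-- Counts only edges with exactly one vertex in `S`; such an edge determines that vertex and the
rest. -/
lemma mul_choose_le_card_crossing (S : Finset (Fin n)) {m : ℕ} (hm : 2 ≤ m) :
    S.card * (n - S.card).choose (m - 1) ≤
      (Finset.univ.filter fun e : Finset (Fin n) =>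
        ((∃ x ∈ e, x ∈ S) ∧ ∃ y ∈ e, y ∉ S) ∧ e.card = m).card := by
  have hcard : (S ×ˢ Finset.powersetCard (m - 1) Sᶜ).card = S.card * (n - S.card).choose (m - 1) := by
    rw [Finset.card_product, Finset.card_powersetCard, Finset.card_compl, Fintype.card_fin]
  rw [← hcard]
  have hmem : ∀ q ∈ S ×ˢ Finset.powersetCard (m - 1) Sᶜ,
      q.1 ∈ S ∧ q.2 ⊆ Sᶜ ∧ q.2.card = m - 1 := by
    intro q hq
    obtain ⟨h1, h2⟩ := Finset.mem_product.mp hq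
    exact ⟨h1, Finset.mem_powersetCard.mp h2⟩
  refine Finset.card_le_card_of_injOn (fun q => insert q.1 q.2) ?_ ?_
  · intro q hq
    obtain ⟨h1, h2, h3⟩ := hmem q hq
    have hne : q.2.Nonempty := Finset.card_pos.mp (by omega)
    obtain ⟨y, hy⟩ := hne
    have hnot : q.1 ∉ q.2 := fun h => Finset.mem_compl.mp (h2 h) h1
    simp only [Finset.coe_filter, Finset.mem_univ, true_and, Set.mem_ofPred_eq]
    refine ⟨⟨⟨q.1, Finset.mem_insert_self _ _, h1⟩, y, Finset.mem_insert_of_mem hy,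
      Finset.mem_compl.mp (h2 hy)⟩, ?_⟩
    rw [Finset.card_insert_of_notMem hnot]
    omega
  · have hS : ∀ q ∈ S ×ˢ Finset.powersetCard (m - 1) Sᶜ,
        insert q.1 q.2 ∩ S = {q.1} ∧ insert q.1 q.2 \ S = q.2 := by
      intro q hq
      obtain ⟨h1, h2, -⟩ := hmem q hq
      have hdisj : Disjoint q.2 S := by
        rw [← Finset.subset_compl_iff_disjoint_right]
        exact h2
      constructor
      · rw [Finset.insert_inter_of_mem h1, Finset.disjoint_iff_inter_eq_empty.mp hdisj]
        rfl
      · rw [Finset.insert_sdiff_of_mem _ h1, Finset.sdiff_eq_self_of_disjoint hdisj]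
    intro q hq q' hq' h
    simp only at h
    obtain ⟨a1, a2⟩ := hS q hq
    obtain ⟨b1, b2⟩ := hS q' hq'
    refine Prod.ext ?_ ?_
    · rw [h, b1] at a1
      exact (Finset.singleton_inj.mp a1).symm
    · rw [← a2, h, b2]

lemma card_touching_le (S : Finset (Fin n)) (m : ℕ) :
    (Finset.univ.filter fun e : Finset (Fin n) => (∃ x ∈ e, x ∈ S) ∧ e.card = m).card ≤
      S.card * n ^ (m - 1) := by
  have hcard : (S ×ˢ Finset.powersetCard (m - 1) (Finset.univ : Finset (Fin n))).card ≤
      S.card * n ^ (m - 1) := by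
    rw [Finset.card_product, Finset.card_powersetCard, Finset.card_univ, Fintype.card_fin]
    exact Nat.mul_le_mul_left _ (Nat.choose_le_pow _ _)
  refine le_trans (Finset.card_le_card fun e he => ?_)
    ((Finset.card_image_le (f := fun q : Fin n × Finset (Fin n) => insert q.1 q.2)).trans hcard)
  obtain ⟨-, ⟨x, hxe, hxS⟩, hem⟩ := Finset.mem_filter.mp he
  refine Finset.mem_image.mpr ⟨(x, e.erase x), Finset.mem_product.mpr ⟨hxS, ?_⟩,
    Finset.insert_erase hxe⟩
  rw [Finset.mem_powersetCard, Finset.card_erase_of_mem hxe, hem]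
  exact ⟨Finset.subset_univ _, rfl⟩

lemma pow_le_mul_choose {M m s : ℕ} (hmM : m ≤ M) (hn : 4 * M ≤ n) (hs : 2 * s ≤ n) :
    (n : ℝ) ^ (m - 1) ≤ 4 ^ M * (M.factorial : ℝ) * (n - s).choose (m - 1) := by
  -- At least `n / 2` vertices lie outside the set, and removing fewer than `M ≤ n / 4` more leaves
  -- at least `n / 4` candidates for each factor of the binomial coefficient.
  have h1 : n ≤ 4 * (n - s + 1 - (m - 1)) := by omega
  have h2 := Nat.pow_le_choose (α := ℝ) (m - 1) (n - s)
  rw [div_le_iff₀ (by exact_mod_cast Nat.factorial_pos _)] at h2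
  have h3 : (n : ℝ) ^ (m - 1) ≤ 4 ^ (m - 1) * (((n - s + 1 - (m - 1)) ^ (m - 1) : ℕ) : ℝ) := by
    rw [Nat.cast_pow, ← mul_pow]
    gcongr
    exact_mod_cast h1
  have h4 : (4 : ℝ) ^ (m - 1) ≤ 4 ^ M := pow_le_pow_right₀ (by norm_num) (by omega)
  have h5 : ((m - 1).factorial : ℝ) ≤ M.factorial := by
    exact_mod_cast Nat.factorial_le (by omega)
  calc (n : ℝ) ^ (m - 1) ≤ 4 ^ (m - 1) * (((n - s + 1 - (m - 1)) ^ (m - 1) : ℕ) : ℝ) := h3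
    _ ≤ 4 ^ M * ((n - s).choose (m - 1) * M.factorial) := by
        push_cast at h2 ⊢
        refine mul_le_mul h4 (h2.trans ?_) (by positivity) (by positivity)
        gcongr
    _ = _ := by ring

/-- The sum of `p e` over all `e` with `2 ≤ |e| ≤ M` and `Q e`. -/
lemma sum_filter_card_eq (M : ℕ) (p : Finset (Fin n) → ℝ) (Q : Finset (Fin n) → Prop)
    [DecidablePred Q] :
    ∑ e ∈ Finset.univ.filter (fun e : Finset (Fin n) => (2 ≤ e.card ∧ e.card ≤ M) ∧ Q e), p e =
      ∑ m ∈ Finset.Icc 2 M, ∑ e ∈ Finset.univ.filter (fun e : Finset (Fin n) => Q e ∧ e.card = m),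
        p e := by
  rw [← Finset.sum_fiberwise_of_maps_to (g := Finset.card) (t := Finset.Icc 2 M)
    (fun e he => Finset.mem_Icc.mpr (Finset.mem_filter.mp he).2.1)]
  refine Finset.sum_congr rfl fun m hm => Finset.sum_congr ?_ fun _ _ => rfl
  obtain ⟨h2, hM⟩ := Finset.mem_Icc.mp hm
  ext e
  simp only [Finset.mem_filter, Finset.mem_univ, true_and]
  constructor
  · rintro ⟨⟨-, hQ⟩, h⟩
    exact ⟨hQ, h⟩
  · rintro ⟨hQ, h⟩
    exact ⟨⟨⟨by omega, by omega⟩, hQ⟩, h⟩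

variable {M : ℕ} {p : Finset (Fin n) → ℝ}

lemma xiMinus_mul_le (hp : ∀ e : Finset (Fin n), 2 ≤ e.card → e.card ≤ M → 0 ≤ p e)
    (hn : 4 * M ≤ n) {S : Finset (Fin n)} (hS : 2 * S.card ≤ n) :
    xiMinus M p * S.card ≤ 4 ^ M * (M.factorial : ℝ) *
      ∑ e ∈ Finset.univ.filter (fun e : Finset (Fin n) => (2 ≤ e.card ∧ e.card ≤ M) ∧
        ((∃ x ∈ e, x ∈ S) ∧ ∃ y ∈ e, y ∉ S)), p e := by
  rw [sum_filter_card_eq, xiMinus, Finset.sum_mul, Finset.mul_sum]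
  refine Finset.sum_le_sum fun m hm => ?_
  obtain ⟨h2, hM⟩ := Finset.mem_Icc.mp hm
  set I := ⨅ e : {e : Finset (Fin n) // e.card = m}, p e with hI
  have hI0 : 0 ≤ I := Real.iInf_nonneg fun e =>
    hp e (by rw [e.2]; exact h2) (by rw [e.2]; exact hM)
  set F := Finset.univ.filter fun e : Finset (Fin n) =>
        ((∃ x ∈ e, x ∈ S) ∧ ∃ y ∈ e, y ∉ S) ∧ e.card = m with hF
  have h3 : (F.card : ℝ) * I ≤ ∑ e ∈ F, p e := by
    rw [← nsmul_eq_mul]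
    refine Finset.card_nsmul_le_sum _ _ _ fun e he => ?_
    exact ciInf_le (Set.finite_range _).bddBelow
      (⟨e, (Finset.mem_filter.mp he).2.2⟩ : {e : Finset (Fin n) // e.card = m})
  have h4 : (S.card : ℝ) * (n - S.card).choose (m - 1) ≤ F.card := by
    exact_mod_cast mul_choose_le_card_crossing S h2
  calc (n : ℝ) ^ (m - 1) * I * S.card
      ≤ (4 ^ M * (M.factorial : ℝ) * (n - S.card).choose (m - 1)) * I * S.card := by
        gcongr
        exact pow_le_mul_choose hM hn hS
    _ = 4 ^ M * (M.factorial : ℝ) * ((S.card * (n - S.card).choose (m - 1)) * I) := by ring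
    _ ≤ 4 ^ M * (M.factorial : ℝ) * (F.card * I) := by gcongr
    _ ≤ _ := by gcongr

lemma sum_touching_le (hp : ∀ e : Finset (Fin n), 2 ≤ e.card → e.card ≤ M → 0 ≤ p e)
    (S : Finset (Fin n)) :
    ∑ e ∈ Finset.univ.filter (fun e : Finset (Fin n) => (2 ≤ e.card ∧ e.card ≤ M) ∧
        ∃ x ∈ e, x ∈ S), p e ≤ xiPlus M p * S.card := by
  rw [sum_filter_card_eq, xiPlus, Finset.sum_mul]
  refine Finset.sum_le_sum fun m hm => ?_
  obtain ⟨h2, hM⟩ := Finset.mem_Icc.mp hm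
  set I := ⨆ e : {e : Finset (Fin n) // e.card = m}, p e with hI
  have hI0 : 0 ≤ I := Real.iSup_nonneg fun e =>
    hp e (by rw [e.2]; exact h2) (by rw [e.2]; exact hM)
  have h3 := Finset.sum_le_card_nsmul
    (Finset.univ.filter fun e : Finset (Fin n) => (∃ x ∈ e, x ∈ S) ∧ e.card = m) p I
    (fun e he => le_ciSup (f := fun e : {e : Finset (Fin n) // e.card = m} => p e)
      (Set.finite_range _).bddAbove ⟨e, (Finset.mem_filter.mp he).2.2⟩)
  refine h3.trans ?_
  rw [nsmul_eq_mul]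
  have h4 : ((Finset.univ.filter fun e : Finset (Fin n) => (∃ x ∈ e, x ∈ S) ∧ e.card = m).card : ℝ)
      ≤ S.card * (n : ℝ) ^ (m - 1) := by
    exact_mod_cast card_touching_le S m
  calc _ ≤ (S.card * (n : ℝ) ^ (m - 1)) * I := by gcongr
    _ = _ := by ring

/-- For `M ≤ n` there is a set of each size `m ≤ M`, so infimum and supremum run over nonempty
families. -/
lemma xiMinus_le_xiPlus (hn : M ≤ n) : xiMinus M p ≤ xiPlus M p := by
  refine Finset.sum_le_sum fun m hm => ?_
  obtain ⟨h2, hM⟩ := Finset.mem_Icc.mp hm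
  obtain ⟨e, -, he⟩ := Finset.exists_subset_card_eq
    (show m ≤ (Finset.univ : Finset (Fin n)).card by simp; omega)
  refine mul_le_mul_of_nonneg_left ?_ (by positivity)
  exact (ciInf_le (f := fun e : {e : Finset (Fin n) // e.card = m} => p e)
    (Set.finite_range _).bddBelow ⟨e, he⟩).trans
    (le_ciSup (f := fun e : {e : Finset (Fin n) // e.card = m} => p e)
      (Set.finite_range _).bddAbove ⟨e, he⟩)

end Counting

/-! ### Edge counts in the random hypergraph -/

section RandomHypergraph

variable {Ω : Type*} [MeasurableSpace Ω] {P : Measure Ω} {M n : ℕ}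
  {p : Finset (Fin n) → ℝ} {E : Ω → Finset (Finset (Fin n))}

lemma IsNURHM.prob_nonneg (hE : IsNURHM P M p E) (e : Finset (Fin n)) (h2 : 2 ≤ e.card)
    (hM : e.card ≤ M) : 0 ≤ p e := by
  rw [← hE.prob_mem e h2 hM]
  exact measureReal_nonneg

lemma IsNURHM.card_filter_eq (hE : IsNURHM P M p E) (Q : Finset (Fin n) → Prop)
    [DecidablePred Q] (ω : Ω) :
    (((E ω).filter Q).card : ℝ) =
      (∑ e ∈ Finset.univ.filter (fun e : {e : Finset (Fin n) // 2 ≤ e.card ∧ e.card ≤ M} => Q e),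
        {ω | (e : Finset (Fin n)) ∈ E ω}.indicator fun _ => (1 : ℝ)) ω := by
  classical
  rw [Finset.sum_apply]
  simp only [Set.indicator_apply, Set.mem_ofPred_eq]
  rw [Finset.sum_boole, Nat.cast_inj]
  symm
  refine Finset.card_bij (fun e _ => (e : Finset (Fin n))) ?_ ?_ ?_
  · intro e he
    simp only [Finset.mem_filter, Finset.mem_univ, true_and] at he ⊢
    exact ⟨he.2, he.1⟩
  · exact fun e _ e' _ h => Subtype.ext h
  · intro e he
    obtain ⟨h1, h2⟩ := Finset.mem_filter.mp he
    exact ⟨⟨e, hE.card_mem ω e h1⟩, by simp [h1, h2], rfl⟩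

lemma IsNURHM.sum_prob_eq (hE : IsNURHM P M p E) (Q : Finset (Fin n) → Prop) [DecidablePred Q] :
    ∑ e ∈ Finset.univ.filter (fun e : {e : Finset (Fin n) // 2 ≤ e.card ∧ e.card ≤ M} => Q e),
      P.real {ω | (e : Finset (Fin n)) ∈ E ω} =
    ∑ e ∈ Finset.univ.filter (fun e : Finset (Fin n) => (2 ≤ e.card ∧ e.card ≤ M) ∧ Q e), p e := by
  refine Finset.sum_bij (fun e _ => (e : Finset (Fin n))) ?_ ?_ ?_ ?_
  · intro e he
    simp only [Finset.mem_filter, Finset.mem_univ, true_and] at he ⊢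
    exact ⟨e.2, he⟩
  · exact fun e _ e' _ h => Subtype.ext h
  · intro e he
    obtain ⟨-, h1, h2⟩ := Finset.mem_filter.mp he
    exact ⟨⟨e, h1⟩, by simp [h2], rfl⟩
  · exact fun e _ => hE.prob_mem e e.2.1 e.2.2

variable [IsProbabilityMeasure P]

lemma IsNURHM.crossing_tail (hE : IsNURHM P M p E) (hn : 4 * M ≤ n) (hξ : 0 ≤ xiMinus M p)
    {S : Finset (Fin n)} (hS : 2 * S.card ≤ n) :
    P.real {ω | ((crossing (E ω) S).card : ℝ) ≤
        xiMinus M p / (4 ^ M * M.factorial) * S.card / 4} ≤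
      Real.exp (-(xiMinus M p / (4 ^ M * M.factorial) * S.card / 4)) := by
  have h := measure_sum_indicator_le_div_four (P := P)
    (fun e : {e : Finset (Fin n) // 2 ≤ e.card ∧ e.card ≤ M} => hE.measurableSet_mem e) hE.indep
    (Finset.univ.filter fun e => (∃ x ∈ e.1, x ∈ S) ∧ ∃ y ∈ e.1, y ∉ S)
    (μ := xiMinus M p / (4 ^ M * M.factorial) * S.card) (by positivity) ?_
  · simp only [← hE.card_filter_eq (fun e => (∃ x ∈ e, x ∈ S) ∧ ∃ y ∈ e, y ∉ S)] at h
    convert h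
    ext T
    simp [crossing]
  · rw [hE.sum_prob_eq (fun e => (∃ x ∈ e, x ∈ S) ∧ ∃ y ∈ e, y ∉ S), div_mul_eq_mul_div,
      div_le_iff₀' (by positivity)]
    exact xiMinus_mul_le hE.prob_nonneg hn hS

lemma IsNURHM.touching_tail (hE : IsNURHM P M p E) (S : Finset (Fin n)) :
    P.real {ω | 4 * (xiPlus M p * S.card) ≤ ((touching (E ω) S).card : ℝ)} ≤
      Real.exp (-(2 * (xiPlus M p * S.card))) := by
  have h := measure_four_mul_le_sum_indicator (P := P)
    (fun e : {e : Finset (Fin n) // 2 ≤ e.card ∧ e.card ≤ M} => hE.measurableSet_mem e) hE.indep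
    (Finset.univ.filter fun e => ∃ x ∈ e.1, x ∈ S) (μ := xiPlus M p * S.card) ?_
  · simp only [← hE.card_filter_eq (fun e => ∃ x ∈ e, x ∈ S)] at h
    convert h
    ext T
    simp [touching]
  · rw [hE.sum_prob_eq (fun e => ∃ x ∈ e, x ∈ S)]
    exact sum_touching_le hE.prob_nonneg S

end RandomHypergraph

/-! ### The two likelihoods as breakings -/

section Breakings

variable {n : ℕ} {T : Finset (Fin n)}

/-- The objects ranked at stage `j` or later. -/
def stageSet (σ : Ranking T) (j : Fin T.card) : Finset (Fin n) :=
  (Finset.Ici j).image fun t => (σ t : Fin n)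

/-- The objects of ranks `j` and `t`. -/
def pairSet (σ : Ranking T) (j t : Fin T.card) : Finset (Fin n) :=
  {(σ j : Fin n), (σ t : Fin n)}

lemma ranking_injective (σ : Ranking T) : Function.Injective fun t => (σ t : Fin n) :=
  Subtype.val_injective.comp σ.injective

lemma sum_stageSet (σ : Ranking T) (j : Fin T.card) (f : Fin n → ℝ) :
    ∑ k ∈ stageSet σ j, f k = ∑ t ∈ Finset.Ici j, f (σ t) :=
  Finset.sum_image fun _ _ _ _ h => ranking_injective σ h

lemma sum_pairSet (σ : Ranking T) {j t : Fin T.card} (h : j ≠ t) (f : Fin n → ℝ) :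
    ∑ k ∈ pairSet σ j t, f k = f (σ j) + f (σ t) :=
  Finset.sum_pair fun h' => h (ranking_injective σ h')

lemma mem_stageSet (σ : Ranking T) (j : Fin T.card) : (σ j : Fin n) ∈ stageSet σ j :=
  Finset.mem_image.mpr ⟨j, Finset.mem_Ici.mpr le_rfl, rfl⟩

lemma mem_pairSet (σ : Ranking T) (j t : Fin T.card) : (σ j : Fin n) ∈ pairSet σ j t :=
  Finset.mem_insert_self _ _

lemma stageSet_subset (σ : Ranking T) (j : Fin T.card) : stageSet σ j ⊆ T := by
  intro k hk
  obtain ⟨t, -, rfl⟩ := Finset.mem_image.mp hk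
  exact (σ t).2

lemma pairSet_subset (σ : Ranking T) (j t : Fin T.card) : pairSet σ j t ⊆ T := by
  intro k hk
  rcases Finset.mem_insert.mp hk with rfl | hk
  · exact (σ j).2
  · rw [Finset.mem_singleton.mp hk]
    exact (σ t).2

variable {G : Finset (Finset (Fin n))} {π : ∀ T : Finset (Fin n), Ranking T}

lemma marginalLogLik_eq (y : Finset (Fin n) → ℕ) :
    marginalLogLik G π y = choiceLogLik
      (G.sigma fun T => Finset.univ.filter fun j : Fin T.card => (j : ℕ) < y T)
      (fun c => (π c.1 c.2 : Fin n)) (fun c => stageSet (π c.1) c.2) := by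
  funext u
  rw [choiceLogLik, Finset.sum_sigma, marginalLogLik]
  simp only [sum_stageSet]

lemma quasiLogLik_eq :
    quasiLogLik G π = choiceLogLik
      (G.sigma fun T => (Finset.univ : Finset (Fin T.card)).sigma fun j => Finset.Ioi j)
      (fun c => (π c.1 c.2.1 : Fin n)) (fun c => pairSet (π c.1) c.2.1 c.2.2) := by
  funext u
  rw [choiceLogLik, Finset.sum_sigma, quasiLogLik]
  refine Finset.sum_congr rfl fun T _ => ?_
  rw [Finset.sum_sigma]
  refine Finset.sum_congr rfl fun j _ => Finset.sum_congr rfl fun t ht => ?_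
  rw [sum_pairSet _ (Finset.mem_Ioi.mp ht).ne]

/-- All objects of an edge compete at the first stage, which is included because `y T ≥ 1`. -/
lemma isBreaking_marginal {y : Finset (Fin n) → ℕ} (hy : ∀ T ∈ G, T.Nonempty → 1 ≤ y T) :
    IsBreaking G (G.sigma fun T => Finset.univ.filter fun j : Fin T.card => (j : ℕ) < y T)
      Sigma.fst (fun c => (π c.1 c.2 : Fin n)) (fun c => stageSet (π c.1) c.2) where
  mem _ _ := mem_stageSet _ _
  subset _ _ := stageSet_subset _ _
  edge_mem _ hc := (Finset.mem_sigma.mp hc).1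
  sep T hT x hx z hz _ := by
    have hpos : 0 < T.card := Finset.card_pos.mpr ⟨x, hx⟩
    have hmem : ∀ x ∈ T, x ∈ stageSet (π T) ⟨0, hpos⟩ := fun x hx =>
      Finset.mem_image.mpr ⟨(π T).symm ⟨x, hx⟩, Finset.mem_Ici.mpr (Nat.zero_le _), by simp⟩
    refine ⟨⟨T, ⟨0, hpos⟩⟩, Finset.mem_sigma.mpr ⟨hT, ?_⟩, rfl, hmem x hx, hmem z hz⟩
    exact Finset.mem_filter.mpr ⟨Finset.mem_univ _, hy T hT ⟨x, hx⟩⟩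

lemma isBreaking_quasi :
    IsBreaking G (G.sigma fun T => (Finset.univ : Finset (Fin T.card)).sigma fun j => Finset.Ioi j)
      Sigma.fst (fun c => (π c.1 c.2.1 : Fin n)) (fun c => pairSet (π c.1) c.2.1 c.2.2) where
  mem _ _ := mem_pairSet _ _ _
  subset _ _ := pairSet_subset _ _ _
  edge_mem _ hc := (Finset.mem_sigma.mp hc).1
  sep T hT x hx z hz hxz := by
    have hne : (π T).symm ⟨x, hx⟩ ≠ (π T).symm ⟨z, hz⟩ := fun h =>
      hxz (congrArg Subtype.val ((π T).symm.injective h))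
    rcases lt_or_gt_of_ne hne with h | h
    · refine ⟨⟨T, ⟨(π T).symm ⟨x, hx⟩, (π T).symm ⟨z, hz⟩⟩⟩, ?_, rfl, ?_, ?_⟩
      · simp [hT, h]
      · simp [pairSet]
      · simp [pairSet]
    · refine ⟨⟨T, ⟨(π T).symm ⟨z, hz⟩, (π T).symm ⟨x, hx⟩⟩⟩, ?_, rfl, ?_, ?_⟩
      · simp [hT, h]
      · simp [pairSet]
      · simp [pairSet]

/-- Contribution of an edge, ranked by `σ`, to the score of the marginal likelihood. -/
noncomputable def stageScore (u : Fin n → ℝ) (S : Finset (Fin n)) (y : ℕ) (σ : Ranking T) : ℝ :=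
  ∑ j ∈ Finset.univ.filter (fun j : Fin T.card => (j : ℕ) < y),
    ((if (σ j : Fin n) ∈ S then 1 else 0) - choiceProb u (stageSet σ j) S)

/-- Contribution of an edge, ranked by `σ`, to the score of the quasi likelihood. -/
noncomputable def pairScore (u : Fin n → ℝ) (S : Finset (Fin n)) (σ : Ranking T) : ℝ :=
  ∑ j : Fin T.card, ∑ t ∈ Finset.Ioi j,
    ((if (σ j : Fin n) ∈ S then 1 else 0) - choiceProb u (pairSet σ j t) S)

lemma choiceScore_marginal (y : Finset (Fin n) → ℕ) (u : Fin n → ℝ) (S : Finset (Fin n)) :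
    choiceScore (G.sigma fun T => Finset.univ.filter fun j : Fin T.card => (j : ℕ) < y T)
      (fun c => (π c.1 c.2 : Fin n)) (fun c => stageSet (π c.1) c.2) u S =
      ∑ T ∈ G, stageScore u S (y T) (π T) := by
  rw [choiceScore, Finset.sum_sigma]
  rfl

lemma choiceScore_quasi (u : Fin n → ℝ) (S : Finset (Fin n)) :
    choiceScore (G.sigma fun T => (Finset.univ : Finset (Fin T.card)).sigma fun j => Finset.Ioi j)
      (fun c => (π c.1 c.2.1 : Fin n)) (fun c => pairSet (π c.1) c.2.1 c.2.2) u S =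
      ∑ T ∈ G, pairScore u S (π T) := by
  rw [choiceScore, Finset.sum_sigma]
  refine Finset.sum_congr rfl fun T _ => ?_
  rw [Finset.sum_sigma]
  rfl

/-- In an edge that does not cross `S`, the choice lands in `S` with probability zero or one and
carries no randomness for the score. -/
lemma choiceTerm_eq_zero {A S : Finset (Fin n)} {k : Fin n} (hAT : A ⊆ T) (hk : k ∈ A)
    (h : ¬((∃ x ∈ T, x ∈ S) ∧ ∃ y ∈ T, y ∉ S)) (u : Fin n → ℝ) :
    (if k ∈ S then 1 else 0) - choiceProb u A S = 0 := by
  by_cases h1 : ∃ x ∈ T, x ∈ S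
  · have hTS : T ⊆ S := by
      intro y hy
      by_contra hyS
      exact h ⟨h1, y, hy, hyS⟩
    rw [if_pos (hTS (hAT hk)), choiceProb_of_subset ⟨k, hk⟩ (hAT.trans hTS), sub_self]
  · have hdisj : Disjoint A S := Finset.disjoint_left.mpr fun x hxA hxS => h1 ⟨x, hAT hxA, hxS⟩
    rw [if_neg fun hkS => h1 ⟨k, hAT hk, hkS⟩, choiceProb_of_disjoint hdisj, sub_self]

lemma abs_choiceTerm_le (u : Fin n → ℝ) (A S : Finset (Fin n)) (k : Fin n) :
    |(if k ∈ S then 1 else 0) - choiceProb u A S| ≤ 1 := by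
  have h0 := choiceProb_nonneg u A S
  have h1 := choiceProb_le_one u A S
  rw [abs_le]
  split_ifs <;> constructor <;> linarith

lemma stageScore_eq_zero {S : Finset (Fin n)} (h : ¬((∃ x ∈ T, x ∈ S) ∧ ∃ y ∈ T, y ∉ S))
    (u : Fin n → ℝ) (y : ℕ) (σ : Ranking T) : stageScore u S y σ = 0 :=
  Finset.sum_eq_zero fun j _ =>
    choiceTerm_eq_zero (stageSet_subset σ j) (mem_stageSet σ j) h u

lemma pairScore_eq_zero {S : Finset (Fin n)} (h : ¬((∃ x ∈ T, x ∈ S) ∧ ∃ y ∈ T, y ∉ S))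
    (u : Fin n → ℝ) (σ : Ranking T) : pairScore u S σ = 0 :=
  Finset.sum_eq_zero fun j _ => Finset.sum_eq_zero fun t _ =>
    choiceTerm_eq_zero (pairSet_subset σ j t) (mem_pairSet σ j t) h u

lemma abs_stageScore_le (u : Fin n → ℝ) (S : Finset (Fin n)) (y : ℕ) (σ : Ranking T) :
    |stageScore u S y σ| ≤ T.card := by
  refine (Finset.abs_sum_le_sum_abs _ _).trans ?_
  refine (Finset.sum_le_sum_of_subset_of_nonneg (Finset.filter_subset _ _)
    fun _ _ _ => abs_nonneg _).trans ?_
  refine (Finset.sum_le_sum fun j _ => abs_choiceTerm_le u _ S _).trans_eq ?_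
  simp

lemma abs_pairScore_le (u : Fin n → ℝ) (S : Finset (Fin n)) (σ : Ranking T) :
    |pairScore u S σ| ≤ (T.card : ℝ) ^ 2 := by
  refine (Finset.abs_sum_le_sum_abs _ _).trans ?_
  have h : ∀ j : Fin T.card, |∑ t ∈ Finset.Ioi j,
      ((if (σ j : Fin n) ∈ S then 1 else 0) - choiceProb u (pairSet σ j t) S)| ≤ (T.card : ℝ) := by
    intro j
    refine (Finset.abs_sum_le_sum_abs _ _).trans ?_
    refine (Finset.sum_le_sum_of_subset_of_nonneg (Finset.subset_univ _)
      fun _ _ _ => abs_nonneg _).trans ?_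
    refine (Finset.sum_le_sum fun t _ => abs_choiceTerm_le u _ S _).trans_eq ?_
    simp
  refine (Finset.sum_le_sum fun j _ => h j).trans_eq ?_
  simp [sq]

lemma choiceProb_eq_sum_mul (u : Fin n → ℝ) (A S : Finset (Fin n)) :
    choiceProb u A S =
      (∑ k ∈ A, (if k ∈ S then 1 else 0) * Real.exp (u k)) / ∑ k ∈ A, Real.exp (u k) := by
  simp only [choiceProb, ite_mul, one_mul, zero_mul, Finset.sum_ite_mem]

lemma sum_plProb_mul_stageScore (u : Fin n → ℝ) (S : Finset (Fin n)) (y : ℕ)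
    (T : Finset (Fin n)) : ∑ σ : Ranking T, plProb u σ * stageScore u S y σ = 0 := by
  simp only [stageScore, Finset.mul_sum]
  rw [Finset.sum_comm]
  refine Finset.sum_eq_zero fun j _ => ?_
  simp only [choiceProb_eq_sum_mul, sum_stageSet]
  exact sum_plWeight_mul_stage (Fintype.card_coe T) (v := fun k : T => Real.exp (u k))
    (fun k => Real.exp_pos _) (fun k : T => if (k : Fin n) ∈ S then 1 else 0) j

lemma sum_plProb_mul_pairScore (u : Fin n → ℝ) (S T : Finset (Fin n)) :
    ∑ σ : Ranking T, plProb u σ * pairScore u S σ = 0 := by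
  rw [← sum_plWeight_mul_pairs (Fintype.card_coe T) (v := fun k : T => Real.exp (u k))
    (fun k => Real.exp_pos _) (fun k : T => if (k : Fin n) ∈ S then 1 else 0)]
  refine Finset.sum_congr rfl fun σ _ => ?_
  rw [plProb_eq_plWeight]
  congr 1
  refine Finset.sum_congr rfl fun j _ => Finset.sum_congr rfl fun t ht => ?_
  have hjt := (Finset.mem_Ioi.mp ht).ne
  rw [choiceProb_eq_sum_mul, sum_pairSet _ hjt, sum_pairSet _ hjt]

end Breakings

/-! ### Union bound over vertex sets -/

section Concentration

variable {Ω : Type*} [MeasurableSpace Ω] {P : Measure Ω} [IsProbabilityMeasure P] {n : ℕ}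

/-- A bound `n ^ (-4 |S|) ≤ n ^ (-2) * n ^ (-|S|)` beats the number of sets: `n ^ (-|S|)` summed
over all `S` is `(1 + 1 / n) ^ n ≤ e`, and the spare `n ^ (-2)` is summable. -/
lemma measure_exists_finset_le (hn : 1 ≤ n) {B : Finset (Fin n) → Set Ω} {c : ℝ} (hc : 0 ≤ c)
    (hB : ∀ S : Finset (Fin n), S.Nonempty →
      P.real (B S) ≤ c * Real.exp (-(4 * S.card * Real.log n))) :
    P.real {ω | ∃ S : Finset (Fin n), S.Nonempty ∧ ω ∈ B S} ≤ 3 * c / (n : ℝ) ^ 2 := by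
  have hn0 : (0 : ℝ) < n := by exact_mod_cast hn
  have hn1 : (1 : ℝ) ≤ n := by exact_mod_cast hn
  have hpow : ∀ S : Finset (Fin n), S.Nonempty →
      Real.exp (-(4 * S.card * Real.log n)) ≤ ((n : ℝ)⁻¹) ^ 2 * ((n : ℝ)⁻¹) ^ S.card := by
    intro S hS
    have hS1 : 1 ≤ S.card := Finset.card_pos.mpr hS
    have : Real.exp (-(4 * S.card * Real.log n)) = ((n : ℝ)⁻¹) ^ (4 * S.card) := by
      rw [← Real.exp_log (inv_pos.mpr hn0), ← Real.exp_nat_mul, Real.log_inv]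
      congr 1
      push_cast
      ring
    rw [this, ← pow_add]
    exact pow_le_pow_of_le_one (inv_pos.mpr hn0).le (inv_le_one_of_one_le₀ hn1) (by omega)
  have hsum : ∑ S : Finset (Fin n), ((n : ℝ)⁻¹) ^ S.card ≤ 3 := by
    have h := Finset.sum_pow_mul_eq_add_pow ((n : ℝ)⁻¹) 1 (Finset.univ : Finset (Fin n))
    simp only [one_pow, mul_one, Finset.powerset_univ, Finset.card_univ, Fintype.card_fin] at h
    rw [h]
    calc ((n : ℝ)⁻¹ + 1) ^ n ≤ Real.exp ((n : ℝ)⁻¹) ^ n := by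
          gcongr
          exact Real.add_one_le_exp _
      _ = Real.exp 1 := by rw [← Real.exp_nat_mul, mul_inv_cancel₀ hn0.ne']
      _ ≤ 3 := by linarith [Real.exp_one_lt_d9]
  have hsub : {ω | ∃ S : Finset (Fin n), S.Nonempty ∧ ω ∈ B S} ⊆
      ⋃ S ∈ Finset.univ.filter (fun S : Finset (Fin n) => S.Nonempty), B S := by
    rintro ω ⟨S, hS, hω⟩
    simp only [Set.mem_iUnion]
    exact ⟨S, by simpa using hS, hω⟩
  refine (measureReal_mono hsub (measure_ne_top _ _)).trans
    ((measureReal_biUnion_finset_le _ _).trans ?_)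
  calc _ ≤ ∑ S ∈ Finset.univ.filter (fun S : Finset (Fin n) => S.Nonempty),
        c * (((n : ℝ)⁻¹) ^ 2 * ((n : ℝ)⁻¹) ^ S.card) := by
        refine Finset.sum_le_sum fun S hS => ?_
        have hS' := (Finset.mem_filter.mp hS).2
        exact (hB S hS').trans (mul_le_mul_of_nonneg_left (hpow S hS') hc)
    _ ≤ ∑ S : Finset (Fin n), c * (((n : ℝ)⁻¹) ^ 2 * ((n : ℝ)⁻¹) ^ S.card) :=
        Finset.sum_le_sum_of_subset_of_nonneg (Finset.subset_univ _) fun _ _ _ => by positivity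
    _ = c * ((n : ℝ)⁻¹) ^ 2 * ∑ S : Finset (Fin n), ((n : ℝ)⁻¹) ^ S.card := by
        rw [Finset.mul_sum]
        exact Finset.sum_congr rfl fun _ _ => by ring
    _ ≤ c * ((n : ℝ)⁻¹) ^ 2 * 3 := by gcongr
    _ = _ := by
        rw [inv_pow]
        ring

variable {M : ℕ} {p : Finset (Fin n) → ℝ} {E : Ω → Finset (Finset (Fin n))} {u : Fin n → ℝ}
  {π : Ω → ∀ T : Finset (Fin n), Ranking T}

lemma IsPLSample.score_tail (hπ : IsPLSample P u E π) (hE : IsNURHM P M p E)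
    {X : Finset (Finset (Fin n)) → ∀ T : Finset (Fin n), Ranking T → ℝ} {S : Finset (Fin n)}
    (hX0 : ∀ G, ∀ T : Finset (Fin n), ¬((∃ x ∈ T, x ∈ S) ∧ ∃ y ∈ T, y ∉ S) → ∀ σ, X G T σ = 0)
    (hXb : ∀ G, ∀ T : Finset (Fin n), T.card ≤ M → ∀ σ, |X G T σ| ≤ (M : ℝ) ^ 2 + 1)
    (hXm : ∀ G T, ∑ σ, plProb u σ * X G T σ = 0) :
    P.real {ω | 3 * ((M : ℝ) ^ 2 + 1) * √((crossing (E ω) S).card * S.card * Real.log n) <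
        |∑ T ∈ E ω, X (E ω) T (π ω T)|} ≤
      2 * Real.exp (-(4 * S.card * Real.log n)) := by
  have hlog : 0 ≤ Real.log n := Real.log_natCast_nonneg n
  have h := hπ.abs_tail hE.measurableSet_mem (X := X) (D := fun G => crossing G S)
    (fun G => crossing_subset G S)
    (fun G T hT hTD σ => hX0 G T (fun h => hTD (mem_crossing.mpr ⟨hT, h⟩)) σ)
    (b := (M : ℝ) ^ 2 + 1) (by positivity)
    (fun ω T hT σ => hXb _ T (hE.card_mem ω T hT).2 σ) hXm
    (q := 4 * S.card * Real.log n) (by positivity)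
  refine (measureReal_mono (fun ω hω => ?_) (measure_ne_top _ _)).trans h
  simp only [Set.mem_ofPred_eq] at hω ⊢
  refine lt_of_le_of_lt ?_ hω
  -- Hoeffding at `q = 4 |S| log n` gives the factor `√8`, rounded up to `3`.
  have h8 : 2 * (4 * S.card * Real.log n) * (crossing (E ω) S).card ≤
      3 ^ 2 * ((crossing (E ω) S).card * S.card * Real.log n) := by
    have : 0 ≤ ((crossing (E ω) S).card * S.card * Real.log n : ℝ) := by positivity
    linarith
  calc ((M : ℝ) ^ 2 + 1) * √(2 * (4 * S.card * Real.log n) * (crossing (E ω) S).card)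
      ≤ ((M : ℝ) ^ 2 + 1) * √(3 ^ 2 * ((crossing (E ω) S).card * S.card * Real.log n)) := by
        gcongr
    _ = _ := by
        rw [Real.sqrt_mul (by norm_num), Real.sqrt_sq (by norm_num)]
        ring

/-- The exceptional event off which the random comparisons are regular. -/
def badEvent (M : ℕ) (p : Finset (Fin n) → ℝ) (u : Fin n → ℝ) (E : Ω → Finset (Finset (Fin n)))
    (π : Ω → ∀ T : Finset (Fin n), Ranking T)
    (y : Finset (Finset (Fin n)) → Finset (Fin n) → ℕ) : Set Ω :=
  {ω | ∃ S : Finset (Fin n), S.Nonempty ∧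
    ((2 * S.card ≤ n ∧
        (crossing (E ω) S).card ≤ xiMinus M p / (4 ^ M * M.factorial) * S.card / 4) ∨
      4 * (xiPlus M p * S.card) ≤ (touching (E ω) S).card ∨
      3 * ((M : ℝ) ^ 2 + 1) * √((crossing (E ω) S).card * S.card * Real.log n) <
        |∑ T ∈ E ω, stageScore u S (y (E ω) T) (π ω T)| ∨
      3 * ((M : ℝ) ^ 2 + 1) * √((crossing (E ω) S).card * S.card * Real.log n) <
        |∑ T ∈ E ω, pairScore u S (π ω T)|)}

lemma measure_badEvent_le (hπ : IsPLSample P u E π) (hE : IsNURHM P M p E) (hn : 1 ≤ n)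
    (hnM : 4 * M ≤ n) (hξ : 16 * (4 ^ M * M.factorial) * Real.log n ≤ xiMinus M p)
    (y : Finset (Finset (Fin n)) → Finset (Fin n) → ℕ) :
    P.real (badEvent M p u E π y) ≤ 18 / (n : ℝ) ^ 2 := by
  have hlog : 0 ≤ Real.log n := Real.log_natCast_nonneg n
  have hc0 : (1 : ℝ) ≤ 4 ^ M * M.factorial := by
    exact_mod_cast Nat.one_le_iff_ne_zero.mpr (by positivity)
  have hξ0 : 0 ≤ xiMinus M p := le_trans (by positivity) hξ
  have hξp : xiMinus M p ≤ xiPlus M p := xiMinus_le_xiPlus (by omega)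
  -- The constant `6 = 1 + 1 + 2 + 2` collects two one-sided Chernoff bounds and two two-sided score
  -- bounds.
  refine (measure_exists_finset_le hn (by norm_num : (0 : ℝ) ≤ 6) fun S hS => ?_).trans_eq
    (by norm_num)
  have hX1 := hπ.score_tail hE (S := S) (X := fun G T σ => stageScore u S (y G T) σ)
    (fun G T h σ => stageScore_eq_zero h u _ σ)
    (fun G T hT σ => (abs_stageScore_le u S _ σ).trans (by
      have hT' : (T.card : ℝ) ≤ M := by exact_mod_cast hT
      nlinarith [sq_nonneg ((M : ℝ) - 1)]))
    (fun G T => sum_plProb_mul_stageScore u S _ T)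
  have hX2 := hπ.score_tail hE (S := S) (X := fun G T σ => pairScore u S σ)
    (fun G T h σ => pairScore_eq_zero h u σ)
    (fun G T hT σ => (abs_pairScore_le u S σ).trans (by
      have hT' : (T.card : ℝ) ^ 2 ≤ (M : ℝ) ^ 2 := by gcongr
      linarith))
    (fun G T => sum_plProb_mul_pairScore u S T)
  have h1 : P.real {ω | 2 * S.card ≤ n ∧ ((crossing (E ω) S).card : ℝ) ≤
      xiMinus M p / (4 ^ M * M.factorial) * S.card / 4} ≤
      Real.exp (-(4 * S.card * Real.log n)) := by
    by_cases hSn : 2 * S.card ≤ n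
    · simp only [hSn, true_and]
      refine (hE.crossing_tail hnM hξ0 hSn).trans (Real.exp_le_exp.mpr (neg_le_neg ?_))
      have : 16 * Real.log n ≤ xiMinus M p / (4 ^ M * M.factorial) := by
        rw [le_div_iff₀ (by positivity)]
        linarith
      calc 4 * S.card * Real.log n = 16 * Real.log n * S.card / 4 := by ring
        _ ≤ _ := by gcongr
    · simp only [hSn, false_and]
      simpa using (Real.exp_pos _).le
  have h2 : P.real {ω | 4 * (xiPlus M p * S.card) ≤ ((touching (E ω) S).card : ℝ)} ≤
      Real.exp (-(4 * S.card * Real.log n)) := by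
    refine (hE.touching_tail S).trans (Real.exp_le_exp.mpr (neg_le_neg ?_))
    have : 2 * Real.log n ≤ xiPlus M p := by nlinarith
    calc 4 * S.card * Real.log n = 2 * (2 * Real.log n * S.card) := by ring
      _ ≤ _ := by gcongr
  refine (measureReal_union_le (μ := P) {ω | 2 * S.card ≤ n ∧ ((crossing (E ω) S).card : ℝ) ≤
      xiMinus M p / (4 ^ M * M.factorial) * S.card / 4} _).trans ?_
  have h3 := measureReal_union_le (μ := P)
    {ω | 4 * (xiPlus M p * S.card) ≤ ((touching (E ω) S).card : ℝ)}
    ({ω | 3 * ((M : ℝ) ^ 2 + 1) * √((crossing (E ω) S).card * S.card * Real.log n) <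
        |∑ T ∈ E ω, stageScore u S (y (E ω) T) (π ω T)|} ∪
      {ω | 3 * ((M : ℝ) ^ 2 + 1) * √((crossing (E ω) S).card * S.card * Real.log n) <
        |∑ T ∈ E ω, pairScore u S (π ω T)|})
  have h4 := measureReal_union_le (μ := P)
    {ω | 3 * ((M : ℝ) ^ 2 + 1) * √((crossing (E ω) S).card * S.card * Real.log n) <
        |∑ T ∈ E ω, stageScore u S (y (E ω) T) (π ω T)|}
      {ω | 3 * ((M : ℝ) ^ 2 + 1) * √((crossing (E ω) S).card * S.card * Real.log n) <
        |∑ T ∈ E ω, pairScore u S (π ω T)|}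
  refine (add_le_add h1 (h3.trans (add_le_add h2 (h4.trans (add_le_add hX1 hX2))))).trans_eq ?_
  ring

end Concentration

/-! ### Choice of constants and the error rate -/

section Estimators

variable {n : ℕ} {ι : Type*} {G : Finset (Finset (Fin n))} {s : Finset ι}
  {e : ι → Finset (Fin n)} {i : ι → Fin n} {A : ι → Finset (Fin n)}

lemma exists_nat_lt_one_add_pow {η x : ℝ} (hη : 0 < η) (hη1 : η ≤ 1) (hx : 1 ≤ Real.log x)
    (hx0 : 0 < x) : ∃ J : ℕ, x / 2 < (1 + η) ^ J ∧ (J : ℝ) ≤ 4 * Real.log x / η := by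
  refine ⟨⌈2 * Real.log x / η⌉₊, ?_, ?_⟩
  · have h1 : Real.exp (η / 2) ≤ 1 + η := by
      have h2 := Real.add_one_le_exp (-(η / 2))
      have h3 : Real.exp (-(η / 2)) * Real.exp (η / 2) = 1 := by
        rw [← Real.exp_add, neg_add_cancel, Real.exp_zero]
      nlinarith [Real.exp_pos (η / 2)]
    calc x / 2 < x := by linarith
      _ = Real.exp (Real.log x) := (Real.exp_log hx0).symm
      _ ≤ Real.exp (⌈2 * Real.log x / η⌉₊ * (η / 2)) := by
          rw [Real.exp_le_exp]
          calc Real.log x = 2 * Real.log x / η * (η / 2) := by field_simp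
            _ ≤ _ := by
              gcongr
              exact Nat.le_ceil _
      _ = Real.exp (η / 2) ^ ⌈2 * Real.log x / η⌉₊ := Real.exp_nat_mul _ _
      _ ≤ _ := by gcongr
  · have h1 : 1 ≤ 2 * Real.log x / η := by
      rw [le_div_iff₀ hη]
      linarith
    have h2 := Nat.ceil_lt_add_one (show 0 ≤ 2 * Real.log x / η by linarith)
    have h3 : 4 * Real.log x / η = 2 * Real.log x / η + 2 * Real.log x / η := by ring
    linarith

/-- Existence, uniqueness and error of the maximum likelihood estimator for regular choices. -/
lemma IsRegular.estimator {u : Fin n → ℝ} {c K ξm ξp B : ℝ} {m : ℕ}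
    (hb : IsBreaking G s e i A)
    (hr : IsRegular G s i A u (ξm / (4 * c)) (4 * ξp) K (Real.log n))
    (hc : 1 ≤ c) (hK : 0 < K) (hξm : 0 < ξm) (hξ : ξm ≤ ξp) (hn : 1 ≤ Real.log n)
    (hm1 : 1 ≤ m) (hm : ∀ T ∈ G, T.card ≤ m) (hB : 0 ≤ B) (hu : ∀ k, |u k| ≤ B)
    (hu0 : ∑ k, u k = 0)
    (hg : 8 * K * m ^ 2 * Real.exp (4 * B) * √(4 * c) * √(Real.log n / ξm) ≤ 1) :
    (∃! w : Fin n → ℝ, IsCenteredMaximizer (choiceLogLik s i A) w) ∧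
    ∀ w : Fin n → ℝ, IsCenteredMaximizer (choiceLogLik s i A) w →
      ‖w - u‖ ≤ 256 * c * (8 * K * m ^ 2 * Real.exp (4 * B) * √(4 * c)) *
        √(ξp ^ 2 * Real.log n ^ 3 / ξm ^ 3) := by
  have hn0 : n ≠ 0 := by
    rintro rfl
    norm_num at hn
  have : NeZero n := ⟨hn0⟩
  have hnpos : (0 : ℝ) < n := by exact_mod_cast Nat.pos_of_ne_zero hn0
  have hm' : (1 : ℝ) ≤ m := by exact_mod_cast hm1
  have hc' : 0 < c := by linarith
  have hξp : 0 < ξp := hξm.trans_le hξ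
  have ha : 0 < ξm / (4 * c) := by positivity
  have hlog : 0 < Real.log n := by linarith
  have hsqrt : √(Real.log n / (ξm / (4 * c))) = √(4 * c) * √(Real.log n / ξm) := by
    rw [← Real.sqrt_mul (by positivity)]
    congr 1
    field_simp
  -- Chosen so that `g / (2 m² exp (4 B))` is `4 K √(L / a)` with `L = log n` and `a = ξm / (4 c)`,
  -- twice the threshold for growth; `g ≤ 1` then also yields the smallness needed for existence.
  set g := 8 * K * m ^ 2 * Real.exp (4 * B) * √(4 * c) * √(Real.log n / ξm) with hgdef
  have hg0 : 0 ≤ g := by positivity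
  have hgeq : g / (2 * m ^ 2 * Real.exp (4 * B)) =
      4 * (K * √(Real.log n / (ξm / (4 * c)))) := by
    rw [hsqrt, hgdef]
    field_simp
    ring
  have hKpos : 0 < K * √(Real.log n / (ξm / (4 * c))) := by positivity
  have hgK : 2 * (K * √(Real.log n / (ξm / (4 * c)))) < g / (2 * m ^ 2 * Real.exp (4 * B)) := by
    rw [hgeq]
    linarith
  have hL : K * √(Real.log n / (ξm / (4 * c))) < 1 / (m * Real.exp (2 * B)) := by
    have h1 : g / (2 * m ^ 2 * Real.exp (4 * B)) ≤ 1 / (m * Real.exp (2 * B)) := by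
      refine div_le_div₀ zero_le_one hg (by positivity) ?_
      have h2 : Real.exp (2 * B) ≤ Real.exp (4 * B) := Real.exp_le_exp.mpr (by linarith)
      have h3 : (m : ℝ) ≤ 2 * m ^ 2 := by nlinarith
      gcongr
    linarith
  have hscore : ∀ w : Fin n → ℝ, IsCenteredMaximizer (choiceLogLik s i A) w →
      ∀ S, choiceScore s i A w S = 0 := fun w hw => choiceScore_eq_zero_of_isMax hb.mem hw.2
  refine ⟨?_, fun w hw => ?_⟩
  · obtain ⟨w, hw0, hw⟩ := hr.exists_isMax hb ha hK.le hm hu hL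
    refine ⟨w, ⟨hw0, hw⟩, fun v hv => ?_⟩
    exact hb.eq_of_score_eq_zero (hr.crossing_nonempty ha) (hscore v hv)
      (hscore w ⟨hw0, hw⟩) hv.1 hw0
  · have hη : ξm / (4 * c) / (2 * (4 * ξp)) = ξm / (32 * c * ξp) := by
      field_simp
      norm_num
    obtain ⟨J, hJ, hJle⟩ := exists_nat_lt_one_add_pow (η := ξm / (32 * c * ξp)) (x := n)
      (by positivity) (by rw [div_le_one (by positivity)]; nlinarith) hn hnpos
    have hnorm := hr.norm_sub_le hb ha (by positivity) hK.le hm hu hg0 hg hgK (J := J)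
      (by rw [hη, Fintype.card_fin]; exact hJ) (hscore w hw) hw.1 hu0
    have hratio : √(ξp ^ 2 * Real.log n ^ 3 / ξm ^ 3) =
        ξp / ξm * Real.log n * √(Real.log n / ξm) := by
      rw [← Real.sqrt_sq (show 0 ≤ ξp / ξm * Real.log n by positivity),
        ← Real.sqrt_mul (by positivity)]
      congr 1
      field_simp
    calc ‖w - u‖ ≤ 2 * J * g := hnorm
      _ ≤ 2 * (4 * Real.log n / (ξm / (32 * c * ξp))) * g := by gcongr
      _ = _ := by
        rw [hratio, hgdef]
        field_simp
        ring

end Estimators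

/-- Makes the sparsity assumption imply `log n / ξ₋ → 0`, which the tail bounds and the condition `g
≤ 1` require. -/
lemma log_div_xiMinus_le_sparsityRatio {M n : ℕ} {p : Finset (Fin n) → ℝ} (hn : M ≤ n)
    (hlog : 1 ≤ Real.log n) (hξ : 0 < xiMinus M p) :
    Real.log n / xiMinus M p ≤ sparsityRatio M p := by
  have hle : xiMinus M p ≤ xiPlus M p := xiMinus_le_xiPlus hn
  rw [sparsityRatio, div_le_div_iff₀ hξ (by positivity)]
  calc Real.log n * xiMinus M p ^ 3 = xiMinus M p ^ 2 * Real.log n ^ 1 * xiMinus M p := by ring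
    _ ≤ xiPlus M p ^ 2 * Real.log n ^ 3 * xiMinus M p := by
        gcongr ?_ ^ 2 * ?_ * _
        exact pow_le_pow_right₀ hlog (by norm_num)

/-! ### Regularity off the exceptional event -/

section Regular

variable {Ω : Type*} {M n : ℕ} {p : Finset (Fin n) → ℝ} {u : Fin n → ℝ}
  {E : Ω → Finset (Finset (Fin n))} {π : Ω → ∀ T : Finset (Fin n), Ranking T}
  {y : Finset (Finset (Fin n)) → Finset (Fin n) → ℕ} {ω : Ω}

lemma lower_of_notMem_badEvent (h : ω ∉ badEvent M p u E π y) (S : Finset (Fin n))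
    (hS : S.Nonempty) (hSn : 2 * S.card ≤ Fintype.card (Fin n)) :
    xiMinus M p / (4 * (4 ^ M * M.factorial)) * S.card ≤ (crossing (E ω) S).card := by
  by_contra! hlt
  refine h ⟨S, hS, Or.inl ⟨by simpa using hSn, hlt.le.trans_eq ?_⟩⟩
  field_simp

lemma upper_of_notMem_badEvent (h : ω ∉ badEvent M p u E π y) (S : Finset (Fin n))
    (hS : S.Nonempty) : (touching (E ω) S).card ≤ 4 * xiPlus M p * S.card := by
  by_contra! hlt
  exact h ⟨S, hS, Or.inr (Or.inl (by rw [← mul_assoc]; exact hlt.le))⟩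

lemma isRegular_marginal_of_notMem_badEvent (h : ω ∉ badEvent M p u E π y) :
    IsRegular (E ω)
      ((E ω).sigma fun T => Finset.univ.filter fun j : Fin T.card => (j : ℕ) < y (E ω) T)
      (fun c => (π ω c.1 c.2 : Fin n)) (fun c => stageSet (π ω c.1) c.2) u
      (xiMinus M p / (4 * (4 ^ M * M.factorial))) (4 * xiPlus M p) (3 * ((M : ℝ) ^ 2 + 1))
      (Real.log n) where
  lower := lower_of_notMem_badEvent h
  upper := upper_of_notMem_badEvent h
  score S hS := by
    rw [choiceScore_marginal]
    by_contra! hlt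
    exact h ⟨S, hS, Or.inr (Or.inr (Or.inl hlt))⟩

lemma isRegular_quasi_of_notMem_badEvent (h : ω ∉ badEvent M p u E π y) :
    IsRegular (E ω)
      ((E ω).sigma fun T => (Finset.univ : Finset (Fin T.card)).sigma fun j => Finset.Ioi j)
      (fun c => (π ω c.1 c.2.1 : Fin n)) (fun c => pairSet (π ω c.1) c.2.1 c.2.2) u
      (xiMinus M p / (4 * (4 ^ M * M.factorial))) (4 * xiPlus M p) (3 * ((M : ℝ) ^ 2 + 1))
      (Real.log n) where
  lower := lower_of_notMem_badEvent h
  upper := upper_of_notMem_badEvent h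
  score S hS := by
    rw [choiceScore_quasi]
    by_contra! hlt
    exact h ⟨S, hS, Or.inr (Or.inr (Or.inr hlt))⟩

end Regular

end PLModel

open PLModel in
theorem mainTheorem3 (M : ℕ) (C₁ : ℝ) (hC₁ : 1 ≤ C₁) :
    ∃ C : ℝ, 0 < C ∧
      ∀ {Ω : Type*} [MeasurableSpace Ω] (P : Measure Ω) [IsProbabilityMeasure P]
        (u : ∀ n : ℕ, Fin n → ℝ)
        (_hu_sum : ∀ n, M ≤ n → ∑ k, u n k = 0)
        (_hu_bdd : ∀ n, M ≤ n → ∀ k, |u n k| ≤ Real.log C₁)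
        (p : ∀ n : ℕ, Finset (Fin n) → ℝ)
        (_hξ_pos : ∀ᶠ n in atTop, 0 < PLModel.xiMinus M (p n))
        (_hξ : Tendsto (fun n => PLModel.sparsityRatio M (p n)) atTop (𝓝 0))
        (E : ∀ n : ℕ, Ω → Finset (Finset (Fin n)))
        (_hE : ∀ n, M ≤ n → PLModel.IsNURHM P M (p n) (E n))
        (π : ∀ n : ℕ, Ω → ∀ T : Finset (Fin n), PLModel.Ranking T)
        (_hπ : ∀ n, M ≤ n → PLModel.IsPLSample P (u n) (E n) (π n))
        (y : ∀ n : ℕ, Finset (Finset (Fin n)) → Finset (Fin n) → ℕ)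
        (_hy : ∀ n G, ∀ T ∈ G, T.Nonempty → 1 ≤ y n G T ∧ y n G T ≤ T.card),
        (∀ᵐ ω ∂P, ∀ᶠ n in atTop,
          (∃! w : Fin n → ℝ, PLModel.IsMarginalMLE (E n ω) (π n ω) (y n (E n ω)) w) ∧
          (∃! w : Fin n → ℝ, PLModel.IsQMLE (E n ω) (π n ω) w) ∧
          ∀ w : Fin n → ℝ,
            PLModel.IsMarginalMLE (E n ω) (π n ω) (y n (E n ω)) w ∨
              PLModel.IsQMLE (E n ω) (π n ω) w →
            ‖w - u n‖ ≤ C * √(PLModel.sparsityRatio M (p n))) ∧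
        Tendsto (fun n => √(PLModel.sparsityRatio M (p n))) atTop (𝓝 0) := by
  set c : ℝ := 4 ^ M * M.factorial with hc
  set K : ℝ := 3 * ((M : ℝ) ^ 2 + 1) with hK
  -- The edge size bound is taken as `M + 1` so that it is at least one even for `M = 0`.
  set D : ℝ := 8 * K * ((M + 1 : ℕ) : ℝ) ^ 2 * Real.exp (4 * Real.log C₁) * √(4 * c) with hD
  have hc1 : 1 ≤ c := by
    rw [hc]
    exact_mod_cast Nat.one_le_iff_ne_zero.mpr (by positivity)
  have hK0 : 0 < K := by positivity
  have hD0 : 0 < D := by positivity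
  refine ⟨256 * c * D, by positivity, ?_⟩
  intro Ω _ P _ u hu_sum hu_bdd p hξ_pos hξ E hE π hπ y hy
  have hsqrt : Tendsto (fun n => √(sparsityRatio M (p n))) atTop (𝓝 0) := by
    simpa using hξ.sqrt
  refine ⟨?_, hsqrt⟩
  have hlarge : ∀ᶠ n : ℕ in atTop, M ≤ n ∧ 4 * M ≤ n ∧ 1 ≤ n ∧ 1 ≤ Real.log n ∧
      0 < xiMinus M (p n) ∧ 16 * c * Real.log n ≤ xiMinus M (p n) ∧
      D * √(Real.log n / xiMinus M (p n)) ≤ 1 := by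
    have hlog : ∀ᶠ n : ℕ in atTop, 1 ≤ Real.log n :=
      (Real.tendsto_log_atTop.comp tendsto_natCast_atTop_atTop).eventually_ge_atTop 1
    filter_upwards [eventually_ge_atTop M, eventually_ge_atTop (4 * M), eventually_ge_atTop 1,
      hlog, hξ_pos, hξ.eventually_le_const (show 0 < 1 / (16 * c) by positivity),
      hsqrt.eventually_le_const (show 0 < 1 / D by positivity)] with n h1 h2 h3 h4 h5 h6 h7
    have h8 := log_div_xiMinus_le_sparsityRatio h1 h4 h5
    refine ⟨h1, h2, h3, h4, h5, ?_, ?_⟩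
    · have h9 := h8.trans h6
      rw [div_le_div_iff₀ h5 (by positivity)] at h9
      linarith
    · rw [← le_div_iff₀' hD0]
      exact (Real.sqrt_le_sqrt h8).trans h7
  have hbad := ae_eventually_notMem_of_le (P := P)
    (bad := fun n => badEvent M (p n) (u n) (E n) (π n) (y n)) (C := 18) (by
      filter_upwards [hlarge] with n ⟨h1, h2, h3, _, _, h6, _⟩
      exact measure_badEvent_le (hπ n h1) (hE n h1) h3 h2 h6 (y n))
  filter_upwards [hbad] with ω hω
  filter_upwards [hω, hlarge] with n hn ⟨h1, h2, h3, h4, h5, h6, h7⟩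
  have hcard : ∀ T ∈ E n ω, T.card ≤ M + 1 := fun T hT =>
    ((hE n h1).card_mem ω T hT).2.trans (Nat.le_succ M)
  obtain ⟨hex₁, hle₁⟩ := IsRegular.estimator
    (isBreaking_marginal (π := π n ω) fun T hT hTne => (hy n (E n ω) T hT hTne).1)
    (isRegular_marginal_of_notMem_badEvent hn) hc1 hK0 h5 (xiMinus_le_xiPlus h1) h4
    (Nat.le_add_left 1 M) hcard (Real.log_nonneg hC₁) (hu_bdd n h1) (hu_sum n h1) h7
  obtain ⟨hex₂, hle₂⟩ := IsRegular.estimator (isBreaking_quasi (π := π n ω))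
    (isRegular_quasi_of_notMem_badEvent hn) hc1 hK0 h5 (xiMinus_le_xiPlus h1) h4
    (Nat.le_add_left 1 M) hcard (Real.log_nonneg hC₁) (hu_bdd n h1) (hu_sum n h1) h7
  simp only [← marginalLogLik_eq] at hex₁ hle₁
  simp only [← quasiLogLik_eq] at hex₂ hle₂
  exact ⟨hex₁, hex₂, fun w hw => hw.elim (hle₁ w) (hle₂ w)⟩
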